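/- Let $|\Psi\rangle$ be one of the resource states $|T\rangle=T|+\rangle$, $|CCZ\rangle=CCZ|+\rangle^{\otimes 3}$, $|CS\rangle=CS|+\rangle^{\otimes 2}$, where $T=\mathrm{diag}(1,e^{i\pi/4})$, $CS=\mathrm{diag}(1,1,1,i)$, $CCZ=\mathrm{diag}(1,1,1,1,1,1,1,-1)$. A protocol with resource state $|\Psi\rangle$ acts on one input qubit and performs finitely many steps, each of which applies a Clifford unitary to the current register, appends an ancilla qubit $|0\rangle$, measures a multi-qubit Pauli operator, tosses a (possibly biased) classical coin, or appends a copy of $|\Psi\rangle$; every step may depend on all earlier outcomes. At the end one qubit is output and the others are discarded. The number $\mathcal N_{|\Psi\rangle}$ of copies of $|\Psi\rangle$ consumed is a random variable, whose distribution depends on the input state through the probabilities of the sequences of outcomes. The protocol approximates a one-qubit unitary $U$ to precision $\varepsilon$ if $\|\mathcal E-U\cdot U^\dagger\|_\diamond\le\varepsilon$, where $\mathcal E$ is the channel of the protocol averaged over all outcomes and $\|\Phi\|_\diamond=\sup_k\sup_{\|X\|_1\le 1}\|(\Phi\otimes \mathrm{id}_k)(X)\|_1$. **Theorem.** Let $C>1$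 and $0<\varepsilon<1/(2^8C)$, and let $$b_{T}=b_{CS}=\tfrac16\log_2(1/\varepsilon)-\tfrac16\log_2 C-1,\qquad b_{CCZ}=\tfrac18\log_2(1/\varepsilon)-\tfrac18\log_2 C-\tfrac34 .$$ 1. Let $U$ be any one-qubit unitary with $2\sqrt{C\varepsilon}\le|\langle 0|U|1\rangle|^2\le 6\sqrt{C\varepsilon}$. For each $\Psi\in\{T,CCZ,CS\}$, every protocol with resource state $|\Psi\rangle$ that approximates $U$ to precision $\varepsilon$ satisfies, for every input state, $\mathcal N_{|\Psi\rangle}\ge b_\Psi$ with probability at least $(C-1)/C$, and hence $\mathbf E\,\mathcal N_{|\Psi\rangle}\ge\frac{C-1}{C}\,b_\Psi$. 2. Unitaries $U$ as in 1 exist. 3. There is also a diagonal one-qubit unitary $U$ for which all the conclusions of 1 hold. Moreover, for every $\varepsilon>0$ there is a diagonal one-qubit unitary $U$ such that every protocol with resource state $|T\rangle$ that approximates $U$ to precision $\varepsilon$ satisfies, for every input state, $\mathbf E\,\mathcal N_{|T\rangle}\ge\frac17\log_2(1/\varepsilon)-\frac43$. -/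

import Mathlib

open scoped Matrix ENNReal ComplexOrder

noncomputable section

/-! ### Registers, Pauli operators, Clifford unitaries -/

/-- Labels of the computational basis of an `n`-qubit register. -/
abbrev Qubits (n : ℕ) : Type := Fin n → Fin 2

/-- A (not necessarily normalized) vector of an `n`-qubit register, in the computational basis. -/
abbrev Ket (n : ℕ) : Type := Qubits n → ℂ

/-- Operators on an `n`-qubit register, in the computational basis. -/
abbrev Op (n : ℕ) : Type := Matrix (Qubits n) (Qubits n) ℂ

/-- Operators on a single qubit, in the computational basis. -/
abbrev QubitOp : Type := Matrix (Fin 2) (Fin 2) ℂ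

/-- The four single-qubit Pauli matrices `I, X, Y, Z`. -/
def pauliMatrix : Fin 4 → QubitOp :=
  ![!![1, 0; 0, 1], !![0, 1; 1, 0], !![0, -Complex.I; Complex.I, 0], !![1, 0; 0, -1]]

/-- The tensor product of single-qubit Pauli matrices with labels `s 0, …, s (n - 1)`. -/
def pauliString {n : ℕ} (s : Fin n → Fin 4) : Op n :=
  Matrix.of fun a b => ∏ i, pauliMatrix (s i) (a i) (b i)

/-- Clifford unitaries: the unitaries that map the Pauli group to itself by conjugation. The image
of a Pauli string is Hermitian, so it is again a Pauli string up to a sign. -/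
def IsClifford {n : ℕ} (V : Op n) : Prop :=
  V ∈ Matrix.unitaryGroup (Qubits n) ℂ ∧
    ∀ s : Fin n → Fin 4, ∃ t : Fin n → Fin 4,
      V * pauliString s * Vᴴ = pauliString t ∨ V * pauliString s * Vᴴ = -pauliString t

/-- The projector `(1 ± P) / 2` of the measurement of the Pauli string `P`; `false` is the outcome
`+1` and `true` is the outcome `-1`. -/
def pauliProjector {n : ℕ} (s : Fin n → Fin 4) (outcome : Bool) : Op n :=
  (1 / 2 : ℂ) • (1 + (if outcome then (-1 : ℂ) else 1) • pauliString s)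

/-! ### Elementary operations on density matrices -/

/-- `ρ ↦ K ρ K†`. -/
def conjBy {m n : Type} [Fintype m] [Fintype n] (K : Matrix m n ℂ) :
    Matrix n n ℂ →ₗ[ℂ] Matrix m m ℂ where
  toFun ρ := K * ρ * Kᴴ
  map_add' ρ σ := by rw [Matrix.mul_add, Matrix.add_mul]
  map_smul' c ρ := by simp

/-- The operator `|φ⟩ ↦ |φ⟩ ⊗ |Ψ⟩` from `n` to `n + r` qubits. -/
def appendKet {r : ℕ} (n : ℕ) (Ψ : Ket r) : Matrix (Qubits (n + r)) (Qubits n) ℂ :=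
  Matrix.of fun a b =>
    if (fun i => a (Fin.castAdd r i)) = b then Ψ (fun j => a (Fin.natAdd n j)) else 0

/-- Partial trace over all qubits of the register except qubit `i`. -/
def reduceTo {n : ℕ} (i : Fin n) : Op n →ₗ[ℂ] QubitOp where
  toFun ρ := Matrix.of fun x y =>
    ∑ a : Qubits n, if a i = x then ρ a (Function.update a i y) else 0
  map_add' ρ σ := by
    ext x y
    simp only [Matrix.of_apply, Matrix.add_apply, ← Finset.sum_add_distrib]
    refine Finset.sum_congr rfl fun a _ => ?_
    split_ifs <;> simp
  map_smul' c ρ := by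
    ext x y
    simp [Finset.mul_sum]

/-- A single-qubit operator, seen as an operator on a register that consists of one qubit. -/
def toRegister : QubitOp →ₗ[ℂ] Op 1 where
  toFun ρ := Matrix.of fun a b => ρ (a 0) (b 0)
  map_add' _ _ := rfl
  map_smul' _ _ := rfl

/-- The single-qubit ket `|0⟩`. -/
def ketZero : Ket 1 := fun a => if a 0 = 0 then 1 else 0

/-! ### Resource states -/

/-- `|+⟩^{⊗ n}`. -/
def ketPlus (n : ℕ) : Ket n := fun _ => 1 / (Real.sqrt (2 ^ n) : ℂ)

/-- The diagonal gate that multiplies `|1…1⟩` by `ω` and fixes all other basis states. -/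
def controlledPhase (n : ℕ) (ω : ℂ) : Op n :=
  Matrix.diagonal fun a => if ∀ i, a i = 1 then ω else 1

/-- `|T⟩ = T|+⟩` with `T = diag(1, e^{iπ/4})`. -/
def ketT : Ket 1 := controlledPhase 1 (Complex.exp (Complex.I * Real.pi / 4)) *ᵥ ketPlus 1

/-- `|CS⟩ = CS|++⟩` with `CS = diag(1, 1, 1, i)`. -/
def ketCS : Ket 2 := controlledPhase 2 Complex.I *ᵥ ketPlus 2

/-- `|CCZ⟩ = CCZ|+++⟩` with `CCZ = diag(1, 1, 1, 1, 1, 1, 1, -1)`. -/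
def ketCCZ : Ket 3 := controlledPhase 3 (-1) *ᵥ ketPlus 3

/-! ### Adaptive protocols -/

/-- Adaptive protocols made of stabilizer operations and copies of the `r`-qubit resource state
`Ψ`, acting on a register that currently holds `n` qubits and ending with a one-qubit output.
Every continuation after a measurement or a classical random choice may depend on the outcome.

* `output i`: stop; qubit `i` is the output and all other qubits are discarded;
* `clifford V`: apply the Clifford unitary `V` to the register;
* `ancilla`: append a qubit in the state `|0⟩` (with Clifford unitaries, any stabilizer state);
* `measure s`: measure the Pauli string with labels `s`;
* `random p`: toss a classical coin that shows `true` with probability `p`;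
* `resource`: append one copy of the resource state `Ψ`. -/
inductive Protocol {r : ℕ} (Ψ : Ket r) : ℕ → Type where
  | output {n : ℕ} (i : Fin n) : Protocol Ψ n
  | clifford {n : ℕ} (V : Op n) (hV : IsClifford V) (next : Protocol Ψ n) : Protocol Ψ n
  | ancilla {n : ℕ} (next : Protocol Ψ (n + 1)) : Protocol Ψ n
  | measure {n : ℕ} (s : Fin n → Fin 4) (next : Bool → Protocol Ψ n) : Protocol Ψ n
  | random {n : ℕ} (p : ℝ) (hp : p ∈ Set.Icc (0 : ℝ) 1) (next : Bool → Protocol Ψ n) :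
      Protocol Ψ n
  | resource {n : ℕ} (next : Protocol Ψ (n + r)) : Protocol Ψ n

/-- The post-selected circuit obtained by fixing all outcomes of a protocol: the number of resource
states that it consumes, and the completely positive map that sends an initial state of the
register to the unnormalized final state of the output qubit. The trace of the latter is the
probability of this sequence of outcomes. -/
structure Branch (n : ℕ) where
  consumed : ℕ
  run : Op n →ₗ[ℂ] QubitOp

namespace Protocol

/-- The post-selected circuits of a protocol, one for every sequence of outcomes. -/
def branches {r : ℕ} {Ψ : Ket r} : {n : ℕ} → Protocol Ψ n → List (Branch n)
  | _, output i => [⟨0, reduceTo i⟩]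
  | _, clifford V _ next =>
      next.branches.map fun b => ⟨b.consumed, b.run ∘ₗ conjBy V⟩
  | n, ancilla next =>
      next.branches.map fun b => ⟨b.consumed, b.run ∘ₗ conjBy (appendKet n ketZero)⟩
  | _, measure s next =>
      ((next false).branches.map fun b =>
          ⟨b.consumed, b.run ∘ₗ conjBy (pauliProjector s false)⟩) ++
        ((next true).branches.map fun b =>
          ⟨b.consumed, b.run ∘ₗ conjBy (pauliProjector s true)⟩)
  | _, random p _ next =>
      ((next false).branches.map fun b => ⟨b.consumed, ((1 - p : ℝ) : ℂ) • b.run⟩) ++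
        ((next true).branches.map fun b => ⟨b.consumed, (p : ℂ) • b.run⟩)
  | n, resource next =>
      next.branches.map fun b => ⟨b.consumed + 1, b.run ∘ₗ conjBy (appendKet n Ψ)⟩

variable {r : ℕ} {Ψ : Ket r}

/-- The single-qubit channel implemented by a protocol, averaged over all outcomes. -/
def channel (π : Protocol Ψ 1) : QubitOp →ₗ[ℂ] QubitOp :=
  (π.branches.map fun b => b.run ∘ₗ toRegister).sum

open Classical in
/-- The probability, for the input state `ρ`, that the number of resource states consumed by the
protocol satisfies `S`. -/
def probConsumed (π : Protocol Ψ 1) (ρ : QubitOp) (S : ℕ → Prop) : ℝ :=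
  (π.branches.map fun b =>
    if S b.consumed then (b.run (toRegister ρ)).trace.re else 0).sum

/-- The expected number of resource states consumed by the protocol for the input state `ρ`. -/
def expectConsumed (π : Protocol Ψ 1) (ρ : QubitOp) : ℝ :=
  (π.branches.map fun b => (b.consumed : ℝ) * (b.run (toRegister ρ)).trace.re).sum

end Protocol

/-! ### Diamond norm -/

/-- The trace norm: the sum of the singular values. -/
def traceNorm {n : Type} [Fintype n] [DecidableEq n] (X : Matrix n n ℂ) : ℝ :=
  ∑ i, Real.sqrt ((Matrix.isHermitian_conjTranspose_mul_self X).eigenvalues i)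

/-- The action of `Φ ⊗ id` on a qubit together with a `k`-dimensional reference system. -/
def ampliate (k : ℕ) (Φ : QubitOp →ₗ[ℂ] QubitOp)
    (X : Matrix (Fin 2 × Fin k) (Fin 2 × Fin k) ℂ) :
    Matrix (Fin 2 × Fin k) (Fin 2 × Fin k) ℂ :=
  Matrix.of fun a b => Φ (Matrix.of fun x y => X (x, a.2) (y, b.2)) a.1 b.1

/-- The diamond norm `sup_k sup_{‖X‖₁ ≤ 1} ‖(Φ ⊗ id_k)(X)‖₁`. -/
def diamondNorm (Φ : QubitOp →ₗ[ℂ] QubitOp) : ℝ≥0∞ :=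
  ⨆ (k : ℕ) (X : Matrix (Fin 2 × Fin k) (Fin 2 × Fin k) ℂ) (_ : traceNorm X ≤ 1),
    ENNReal.ofReal (traceNorm (ampliate k Φ X))

/-! ### Cost of approximating a unitary -/

/-- Density matrices of a single qubit. -/
def IsDensity (ρ : QubitOp) : Prop := ρ.PosSemidef ∧ ρ.trace = 1

/-- The protocol approximates the unitary `U` to within diamond-norm precision `ε`. -/
def Protocol.Approximates {r : ℕ} {Ψ : Ket r} (π : Protocol Ψ 1) (U : QubitOp) (ε : ℝ) : Prop :=
  diamondNorm (π.channel - conjBy U) ≤ ENNReal.ofReal ε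

/-- Every protocol that approximates `U` to precision `ε` consumes, for every input state, at least
`b` copies of `Ψ` with probability at least `p`. -/
def ConsumesWithProb {r : ℕ} (Ψ : Ket r) (U : QubitOp) (ε p b : ℝ) : Prop :=
  ∀ π : Protocol Ψ 1, π.Approximates U ε → ∀ ρ : QubitOp, IsDensity ρ →
    p ≤ π.probConsumed ρ (fun N => b ≤ (N : ℝ))

/-- Every protocol that approximates `U` to precision `ε` consumes, for every input state, at least
`b` copies of `Ψ` in expectation. -/
def ConsumesOnAverage {r : ℕ} (Ψ : Ket r) (U : QubitOp) (ε b : ℝ) : Prop :=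
  ∀ π : Protocol Ψ 1, π.Approximates U ε → ∀ ρ : QubitOp, IsDensity ρ →
    b ≤ π.expectConsumed ρ

/-- `1/6 log₂(1/ε) - 1/6 log₂ C - 1`. -/
def boundT (C ε : ℝ) : ℝ := 1 / 6 * Real.logb 2 (1 / ε) - 1 / 6 * Real.logb 2 C - 1

/-- `1/8 log₂(1/ε) - 1/8 log₂ C - 3/4`. -/
def boundCCZ (C ε : ℝ) : ℝ := 1 / 8 * Real.logb 2 (1 / ε) - 1 / 8 * Real.logb 2 C - 3 / 4

/-- `1/6 log₂(1/ε) - 1/6 log₂ C - 1`. -/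
def boundCS (C ε : ℝ) : ℝ := 1 / 6 * Real.logb 2 (1 / ε) - 1 / 6 * Real.logb 2 C - 1

/-- The lower bounds for `|T⟩`, `|CCZ⟩` and `|CS⟩` on the cost of approximating `U` to precision
`ε`, with probability at least `(C - 1) / C` and on average. -/
def SynthesisBounds (C ε : ℝ) (U : QubitOp) : Prop :=
  (ConsumesWithProb ketT U ε ((C - 1) / C) (boundT C ε) ∧
    ConsumesWithProb ketCCZ U ε ((C - 1) / C) (boundCCZ C ε) ∧
    ConsumesWithProb ketCS U ε ((C - 1) / C) (boundCS C ε)) ∧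
  (ConsumesOnAverage ketT U ε ((C - 1) / C * boundT C ε) ∧
    ConsumesOnAverage ketCCZ U ε ((C - 1) / C * boundCCZ C ε) ∧
    ConsumesOnAverage ketCS U ε ((C - 1) / C * boundCS C ε))

end

open scoped Kronecker

noncomputable section

/-! ### Families of Pauli-like operators -/

/-! Fix all outcomes of a protocol. What remains is a post-selected stabilizer circuit fed with the
input and `N` copies of `Ψ`. In the Heisenberg picture the identity and a Pauli operator on the
output qubit pull back to effects `E` and `h`, where `E` is a nonnegative multiple of a sum over a
group of signed Pauli operators, and `h` is zero or `E * g` for a signed Pauli `g` commuting with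
the group (`Protocol.isStabEffect_branches`). The group enters through a homomorphism that need not
be injective, so redundant and impossible outcomes need no separate treatment.

Pauli expectation values of the resource states are, up to a fixed denominator, integers or elements
of `ℤ[√2]`. A nonzero algebraic integer times its conjugate has absolute value at least one, so the
value of a stabilizer projection on `N` copies is zero or at least `2 ^ (-c N)`, with `c = 3` for
`T` and `CS` and `c = 4` for `CCZ` (`StabilizerGap`, `ConjugateKets.norm_mul_norm_ge`). Hence, on an
eigenstate of `X` or `Z`, the conditional probability in a branch that a final measurement in the
same basis flips the outcome is zero, one half, or at least `2 ^ (-c N)`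
(`Protocol.branch_outcome`).

The target `U` is chosen with flip probability `q` between `2t` and `6t`, where `t = √(Cε)`. A
branch with `2 ^ (c N) * 8t ≤ 1` has flip probability zero, one half, or at least `8t`, hence at
distance at least `2t` from `q`. Its infidelity with the target is then at least `4t² = 4Cε` times
its weight (`infidelity_bound`). Infidelity is linear in the output and at most `ε` for the averaged
channel, so the cheap branches have total weight at most `1/(4C)` on each eigenstate
(`weightBelow_projector_le`). The two eigenprojectors sum to the identity, which dominates every
density matrix; so the cheap branches have weight at most `1/(2C)` for every input.

For a diagonal `U` the eigenbasis of `X` replaces that of `Z`. The last bound comes from choosing `C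
= ε ^ (-1/7)`. -/

/-- The tensor product of a family of square matrices. -/
def piMat {ι α : Type} [Fintype ι] (A : ι → Matrix α α ℂ) : Matrix (ι → α) (ι → α) ℂ :=
  Matrix.of fun a b => ∏ i, A i (a i) (b i)

section piMat

variable {ι α : Type} [Fintype ι]

theorem piMat_apply (A : ι → Matrix α α ℂ) (a b : ι → α) :
    piMat A a b = ∏ i, A i (a i) (b i) := rfl

theorem piMat_mul [DecidableEq ι] [Fintype α] (A B : ι → Matrix α α ℂ) :
    piMat A * piMat B = piMat fun i => A i * B i := by
  ext a b
  simp only [Matrix.mul_apply, piMat_apply, Finset.prod_univ_sum, Fintype.piFinset_univ,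
    Finset.prod_mul_distrib]

theorem piMat_one [DecidableEq α] [DecidableEq (ι → α)] :
    piMat (fun _ : ι => (1 : Matrix α α ℂ)) = 1 := by
  ext a b
  rw [piMat_apply]
  by_cases h : a = b
  · subst h; simp
  · obtain ⟨i, hi⟩ := Function.ne_iff.mp h
    rw [Matrix.one_apply_ne h]
    exact Finset.prod_eq_zero (Finset.mem_univ i) (Matrix.one_apply_ne hi)

theorem piMat_conjTranspose (A : ι → Matrix α α ℂ) : (piMat A)ᴴ = piMat fun i => (A i)ᴴ := by
  ext a b
  simp [piMat_apply, Matrix.conjTranspose_apply]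

theorem trace_piMat [DecidableEq ι] [Fintype α] (A : ι → Matrix α α ℂ) :
    (piMat A).trace = ∏ i, (A i).trace := by
  simp only [Matrix.trace, Matrix.diag_apply, piMat_apply, Finset.prod_univ_sum,
    Fintype.piFinset_univ]

theorem piMat_smul (c : ι → ℂ) (A : ι → Matrix α α ℂ) :
    piMat (fun i => c i • A i) = (∏ i, c i) • piMat A := by
  ext a b
  simp [piMat_apply, Finset.prod_mul_distrib]

end piMat

/-- A family of Hermitian involutions that is closed under products up to phases, and in which
only the identity has non-zero trace. -/
structure IsPauliFamily {K : Type} [Fintype K] [DecidableEq K] (B : Set (Matrix K K ℂ)) :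
    Prop where
  one_mem : 1 ∈ B
  herm : ∀ M ∈ B, Mᴴ = M
  sq : ∀ M ∈ B, M * M = 1
  mul : ∀ M ∈ B, ∀ M' ∈ B, ∃ k : ℕ, ∃ M'' ∈ B, M * M' = Complex.I ^ k • M''
  trace : ∀ M ∈ B, M = 1 ∨ M.trace = 0

namespace IsPauliFamily

theorem pi {ι α : Type} [Fintype ι] [DecidableEq ι] [Fintype α] [DecidableEq α]
    {B : Set (Matrix α α ℂ)} (hB : IsPauliFamily B) :
    IsPauliFamily {M | ∃ A : ι → Matrix α α ℂ, (∀ i, A i ∈ B) ∧ M = piMat A} where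
  one_mem := ⟨fun _ => 1, fun _ => hB.one_mem, piMat_one.symm⟩
  herm := by
    rintro _ ⟨A, hA, rfl⟩
    rw [piMat_conjTranspose]
    exact congrArg piMat (funext fun i => hB.herm _ (hA i))
  sq := by
    rintro _ ⟨A, hA, rfl⟩
    rw [piMat_mul, ← piMat_one]
    exact congrArg piMat (funext fun i => hB.sq _ (hA i))
  mul := by
    rintro _ ⟨A, hA, rfl⟩ _ ⟨A', hA', rfl⟩
    choose k C hC h using fun i => hB.mul _ (hA i) _ (hA' i)
    refine ⟨∑ i, k i, piMat C, ⟨C, hC, rfl⟩, ?_⟩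
    rw [piMat_mul, ← Finset.prod_pow_eq_pow_sum, ← piMat_smul]
    exact congrArg piMat (funext h)
  trace := by
    rintro _ ⟨A, hA, rfl⟩
    by_cases h : ∀ i, A i = 1
    · left
      rw [← piMat_one]
      exact congrArg piMat (funext h)
    · right
      push Not at h
      obtain ⟨i, hi⟩ := h
      rw [trace_piMat]
      exact Finset.prod_eq_zero (Finset.mem_univ i) ((hB.trace _ (hA i)).resolve_left hi)

theorem kronecker {K L : Type} [Fintype K] [DecidableEq K] [Fintype L] [DecidableEq L]
    {B : Set (Matrix K K ℂ)} {C : Set (Matrix L L ℂ)} (hB : IsPauliFamily B)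
    (hC : IsPauliFamily C) :
    IsPauliFamily {M | ∃ P ∈ B, ∃ Q ∈ C, M = P ⊗ₖ Q} where
  one_mem := ⟨1, hB.one_mem, 1, hC.one_mem, (Matrix.one_kronecker_one).symm⟩
  herm := by
    rintro _ ⟨P, hP, Q, hQ, rfl⟩
    rw [Matrix.conjTranspose_kronecker, hB.herm P hP, hC.herm Q hQ]
  sq := by
    rintro _ ⟨P, hP, Q, hQ, rfl⟩
    rw [← Matrix.mul_kronecker_mul, hB.sq P hP, hC.sq Q hQ, Matrix.one_kronecker_one]
  mul := by
    rintro _ ⟨P, hP, Q, hQ, rfl⟩ _ ⟨P', hP', Q', hQ', rfl⟩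
    obtain ⟨k, R, hR, h⟩ := hB.mul P hP P' hP'
    obtain ⟨l, S, hS, h'⟩ := hC.mul Q hQ Q' hQ'
    refine ⟨k + l, _, ⟨R, hR, S, hS, rfl⟩, ?_⟩
    rw [← Matrix.mul_kronecker_mul, h, h', Matrix.smul_kronecker, Matrix.kronecker_smul, smul_smul,
      pow_add]
  trace := by
    rintro _ ⟨P, hP, Q, hQ, rfl⟩
    rw [Matrix.trace_kronecker]
    rcases hB.trace P hP with rfl | h
    · rcases hC.trace Q hQ with rfl | h
      · exact Or.inl Matrix.one_kronecker_one
      · exact Or.inr (by rw [h, mul_zero])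
    · exact Or.inr (by rw [h, zero_mul])

end IsPauliFamily

/-- The elements of a family of operators and their negatives. -/
def signed {K : Type} (B : Set (Matrix K K ℂ)) : Set (Matrix K K ℂ) := {M | M ∈ B ∨ -M ∈ B}

namespace IsPauliFamily

variable {K : Type} [Fintype K] [DecidableEq K] {B : Set (Matrix K K ℂ)} (hB : IsPauliFamily B)
include hB

theorem signed_herm {M : Matrix K K ℂ} (h : M ∈ signed B) : Mᴴ = M := by
  rcases h with h | h
  · exact hB.herm M h
  · have := hB.herm _ h
    rwa [Matrix.conjTranspose_neg, neg_inj] at this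

theorem signed_sq {M : Matrix K K ℂ} (h : M ∈ signed B) : M * M = 1 := by
  rcases h with h | h
  · exact hB.sq M h
  · have := hB.sq _ h
    rwa [neg_mul_neg] at this

theorem signed_mul {M M' : Matrix K K ℂ} (h : M ∈ signed B) (h' : M' ∈ signed B) :
    ∃ k : ℕ, ∃ M'' ∈ B, M * M' = Complex.I ^ k • M'' := by
  have key : ∀ M M' : Matrix K K ℂ, M ∈ B → M' ∈ signed B →
      ∃ k : ℕ, ∃ M'' ∈ B, M * M' = Complex.I ^ k • M'' := by
    rintro M M' h (h' | h')
    · exact hB.mul M h M' h'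
    · obtain ⟨k, N, hN, e⟩ := hB.mul M h _ h'
      refine ⟨k + 2, N, hN, ?_⟩
      rw [pow_add, Complex.I_sq, mul_neg_one, neg_smul, ← e, mul_neg, neg_neg]
  rcases h with h | h
  · exact key M M' h h'
  · obtain ⟨k, N, hN, e⟩ := key _ M' h h'
    refine ⟨k + 2, N, hN, ?_⟩
    rw [pow_add, Complex.I_sq, mul_neg_one, neg_smul, ← e, neg_mul, neg_neg]

theorem commute_or_anticommute {M M' : Matrix K K ℂ} (h : M ∈ signed B) (h' : M' ∈ signed B) :
    M * M' = M' * M ∨ M * M' = -(M' * M) := by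
  obtain ⟨k, N, hN, e⟩ := hB.signed_mul h h'
  -- Adjoints reverse the product and conjugate the phase, so the parity of `k` decides between
  -- commuting and anticommuting.
  have e' : M' * M = (-Complex.I) ^ k • N := by
    have := congrArg Matrix.conjTranspose e
    rwa [Matrix.conjTranspose_mul, hB.signed_herm h, hB.signed_herm h',
      Matrix.conjTranspose_smul, hB.herm N hN, star_pow, Complex.star_def, Complex.conj_I] at this
  rcases Nat.even_or_odd k with hk | hk
  · left; rw [e, e', hk.neg_pow]
  · right; rw [e, e', hk.neg_pow, neg_smul, neg_neg]

theorem signed_mul_of_commute {M M' : Matrix K K ℂ} (h : M ∈ signed B) (h' : M' ∈ signed B)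
    (hc : M * M' = M' * M) : M * M' ∈ signed B := by
  obtain ⟨k, N, hN, e⟩ := hB.signed_mul h h'
  have h1 : (M * M') * (M * M') = 1 := by
    rw [Matrix.mul_assoc, ← Matrix.mul_assoc M', ← hc, Matrix.mul_assoc M, hB.signed_sq h',
      Matrix.mul_one, hB.signed_sq h]
  rw [e, Matrix.smul_mul, Matrix.mul_smul, smul_smul, hB.sq N hN] at h1
  -- A diagonal entry is needed to read off that the phase squares to one; over an empty index type
  -- all matrices agree.
  rcases isEmpty_or_nonempty K with hK | ⟨⟨x⟩⟩
  · left
    rwa [Subsingleton.elim (M * M') N]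
  have h2 : Complex.I ^ k * Complex.I ^ k = 1 := by
    have := congrFun (congrFun h1 x) x
    simpa using this
  rcases mul_self_eq_one_iff.mp h2 with h3 | h3
  · left; rwa [e, h3, one_smul]
  · right; rwa [e, h3, neg_smul, one_smul, neg_neg]

theorem signed_trace {M : Matrix K K ℂ} (h : M ∈ signed B) :
    M = 1 ∨ M = -1 ∨ M.trace = 0 := by
  rcases h with h | h
  · exact (hB.trace M h).imp_right Or.inr
  · rcases hB.trace _ h with h | h
    · exact Or.inr (Or.inl (by rw [← h, neg_neg]))
    · refine Or.inr (Or.inr ?_)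
      rwa [Matrix.trace_neg, neg_eq_zero] at h

end IsPauliFamily

/-! ### Effects of post-selected stabilizer circuits -/

/-- `E` is a non-negative multiple of the sum over a group of signed Pauli operators, and `h` is
either zero or the product of `E` with a signed Pauli operator that commutes with this group. -/
def StabPair {K : Type} [Fintype K] [DecidableEq K] (B : Set (Matrix K K ℂ))
    (E h : Matrix K K ℂ) : Prop :=
  ∃ (Γ : Type) (_ : CommGroup Γ) (_ : Fintype Γ) (φ : Γ →* Matrix K K ℂ) (a : ℝ), 0 ≤ a ∧
    (∀ γ, φ γ ∈ signed B) ∧ E = (a : ℂ) • ∑ γ, φ γ ∧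
    (h = 0 ∨ ∃ g ∈ signed B, (∀ γ, g * φ γ = φ γ * g) ∧ h = E * g)

section StabPair

variable {K : Type} [Fintype K] [DecidableEq K] {B : Set (Matrix K K ℂ)}

theorem StabPair.smul {E h : Matrix K K ℂ} (H : StabPair B E h) {c : ℝ} (hc : 0 ≤ c) :
    StabPair B ((c : ℂ) • E) ((c : ℂ) • h) := by
  obtain ⟨Γ, _, _, φ, a, ha, hφ, rfl, hh⟩ := H
  refine ⟨Γ, inferInstance, inferInstance, φ, c * a, mul_nonneg hc ha, hφ, ?_, ?_⟩
  · rw [smul_smul, Complex.ofReal_mul]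
  · refine hh.imp (fun h0 => by rw [h0, smul_zero]) ?_
    rintro ⟨g, hg, hc', rfl⟩
    exact ⟨g, hg, hc', by rw [Matrix.smul_mul _ (_ • _)]⟩

/-- The subgroup of elements whose image commutes with `Q`. -/
def commutingSubgroup {Γ : Type} [Group Γ] (φ : Γ →* Matrix K K ℂ) (Q : Matrix K K ℂ) :
    Subgroup Γ where
  carrier := {γ | φ γ * Q = Q * φ γ}
  one_mem' := by simp
  mul_mem' := by
    intro x y (hx : _ = _) (hy : _ = _)
    change φ (x * y) * Q = Q * φ (x * y)
    rw [map_mul, mul_assoc, hy, ← mul_assoc, hx, mul_assoc]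
  inv_mem' := by
    intro x (hx : _ = _)
    change φ x⁻¹ * Q = Q * φ x⁻¹
    have h1 : φ x⁻¹ * φ x = 1 := by rw [← map_mul, inv_mul_cancel, map_one]
    have h2 : φ x * φ x⁻¹ = 1 := by rw [← map_mul, mul_inv_cancel, map_one]
    calc φ x⁻¹ * Q = φ x⁻¹ * (Q * φ x) * φ x⁻¹ := by
          rw [mul_assoc, mul_assoc, h2, mul_one]
      _ = Q * φ x⁻¹ := by rw [← hx, ← mul_assoc, h1, one_mul]

-- Inserting `Q` next to `R` and moving it across `M` to be absorbed by `Rᴴ` costs a sign.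
omit [DecidableEq K] in
theorem sandwich_eq_zero {K' : Type} [Fintype K'] {Q M : Matrix K K ℂ} {R : Matrix K K' ℂ}
    (hR : Q * R = R) (hR' : Rᴴ * Q = Rᴴ) (h : M * Q = -(Q * M)) : Rᴴ * M * R = 0 := by
  have h1 : Rᴴ * M * R = -(Rᴴ * M * R) := by
    calc Rᴴ * M * R = Rᴴ * (M * Q) * R := by
          rw [Matrix.mul_assoc, Matrix.mul_assoc, Matrix.mul_assoc, hR]
      _ = -(Rᴴ * M * R) := by
          rw [h, Matrix.mul_neg, Matrix.neg_mul, ← Matrix.mul_assoc Rᴴ Q, hR']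
  ext i j
  exact self_eq_neg.mp (congrFun (congrFun h1 i) j)

/-- Sandwiching with an operator fixed by the signed Pauli operator `Q` only keeps the terms that
commute with `Q`. -/
theorem StabPair.restrict (hB : IsPauliFamily B) {E h : Matrix K K ℂ} (H : StabPair B E h)
    {K' : Type} [Fintype K'] {Q : Matrix K K ℂ} (hQ : Q ∈ signed B) {R : Matrix K K' ℂ}
    (hR : Q * R = R) :
    ∃ (Γ : Type) (_ : CommGroup Γ) (_ : Fintype Γ) (φ : Γ →* Matrix K K ℂ) (a : ℝ), 0 ≤ a ∧
      (∀ γ, φ γ ∈ signed B) ∧ (∀ γ, φ γ * Q = Q * φ γ) ∧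
      Rᴴ * E * R = Rᴴ * ((a : ℂ) • ∑ γ, φ γ) * R ∧
      (Rᴴ * h * R = 0 ∨ ∃ g ∈ signed B, (∀ γ, g * φ γ = φ γ * g) ∧ g * Q = Q * g ∧
        Rᴴ * h * R = Rᴴ * ((a : ℂ) • (∑ γ, φ γ) * g) * R) := by
  classical
  have hR' : Rᴴ * Q = Rᴴ := by
    have := congrArg Matrix.conjTranspose hR
    rwa [Matrix.conjTranspose_mul, hB.signed_herm hQ] at this
  obtain ⟨Γ, _, _, φ, a, ha, hφ, rfl, hh⟩ := H
  have key : ∀ g : Matrix K K ℂ, g * Q = Q * g →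
      Rᴴ * ((a : ℂ) • (∑ γ, φ γ) * g) * R =
        Rᴴ * ((a : ℂ) • (∑ γ : commutingSubgroup φ Q, φ γ) * g) * R := by
    intro g hg
    simp only [Matrix.smul_mul, Matrix.mul_smul, Matrix.sum_mul, Matrix.mul_sum]
    congr 1
    rw [← Finset.sum_subset (Finset.subset_univ
      (Finset.univ.filter fun γ => γ ∈ commutingSubgroup φ Q))]
    · rw [Finset.sum_subtype (p := fun γ => γ ∈ commutingSubgroup φ Q)]
      simp
    · intro γ _ hγ
      have hγ' : ¬ (φ γ * Q = Q * φ γ) := by simpa [commutingSubgroup] using hγ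
      have := (hB.commute_or_anticommute (hφ γ) hQ).resolve_left hγ'
      refine sandwich_eq_zero hR hR' ?_
      rw [mul_assoc, hg, ← mul_assoc, this, neg_mul, mul_assoc]
  refine ⟨commutingSubgroup φ Q, inferInstance, inferInstance,
    φ.comp (commutingSubgroup φ Q).subtype, a, ha, fun γ => hφ γ, fun γ => γ.2, ?_, ?_⟩
  · simpa using key 1 (by simp)
  rcases hh with rfl | ⟨g, hg, hgc, rfl⟩
  · left; simp
  by_cases hgQ : g * Q = Q * g
  · exact Or.inr ⟨g, hg, fun γ => hgc γ, hgQ, key g hgQ⟩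
  have hgQ' := (hB.commute_or_anticommute hg hQ).resolve_left hgQ
  -- Since `g` anticommutes with `Q`, it is corrected by a group element that also anticommutes; the
  -- group sum absorbs that element. Without such an element every term `φ γ * g` anticommutes with
  -- `Q` and is killed.
  by_cases hex : ∃ γ₀, φ γ₀ * Q = -(Q * φ γ₀)
  · obtain ⟨γ₀, h₀⟩ := hex
    have hmem : φ γ₀ * g ∈ signed B := hB.signed_mul_of_commute (hφ γ₀) hg (hgc γ₀).symm
    have hcomm : (φ γ₀ * g) * Q = Q * (φ γ₀ * g) := by
      rw [mul_assoc, hgQ', mul_neg, ← mul_assoc, h₀, neg_mul, neg_neg, mul_assoc]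
    have hE : (∑ γ, φ γ) * φ γ₀ = ∑ γ, φ γ := by
      rw [Finset.sum_mul, ← Equiv.sum_comp (Equiv.mulRight γ₀) φ]
      simp
    have hall : ∀ γ, (φ γ₀ * g) * φ γ = φ γ * (φ γ₀ * g) := by
      intro γ
      rw [mul_assoc, hgc, ← mul_assoc, ← map_mul, mul_comm γ₀, map_mul, mul_assoc]
    refine Or.inr ⟨φ γ₀ * g, hmem, fun γ => hall γ, hcomm, ?_⟩
    refine Eq.trans ?_ (key _ hcomm)
    rw [Matrix.smul_mul, Matrix.smul_mul, ← mul_assoc, hE]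
  · left
    push Not at hex
    simp only [Matrix.smul_mul, Matrix.mul_smul, Matrix.sum_mul, Matrix.mul_sum]
    rw [Finset.sum_eq_zero, smul_zero]
    intro γ _
    have hγ := (hB.commute_or_anticommute (hφ γ) hQ).resolve_right (hex γ)
    refine sandwich_eq_zero hR hR' ?_
    rw [mul_assoc, hgQ', mul_neg, ← mul_assoc, hγ, mul_assoc]

end StabPair

section StabPair

variable {K : Type} [Fintype K] [DecidableEq K] {B : Set (Matrix K K ℂ)}

/-- Extension of a group of operators by a commuting involution. -/
def extendHom {Γ : Type} [CommGroup Γ] (φ : Γ →* Matrix K K ℂ) (Q : Matrix K K ℂ)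
    (hQ : Q * Q = 1) (hc : ∀ γ, φ γ * Q = Q * φ γ) : Γ × ℤˣ →* Matrix K K ℂ where
  toFun x := φ x.1 * if x.2 = 1 then 1 else Q
  map_one' := by simp
  map_mul' := by
    rintro ⟨γ, j⟩ ⟨γ', j'⟩
    rcases Int.units_eq_one_or j with rfl | rfl <;> rcases Int.units_eq_one_or j' with rfl | rfl <;>
      simp [mul_assoc]
    · rw [hc]
    · rw [← mul_assoc Q, ← hc, mul_assoc, hQ, mul_one]

theorem sum_extendHom {Γ : Type} [CommGroup Γ] [Fintype Γ] (φ : Γ →* Matrix K K ℂ)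
    (Q : Matrix K K ℂ) (hQ : Q * Q = 1) (hc : ∀ γ, φ γ * Q = Q * φ γ) :
    ∑ x, extendHom φ Q hQ hc x = (∑ γ, φ γ) * (1 + Q) := by
  rw [Fintype.sum_prod_type, Finset.sum_mul]
  refine Finset.sum_congr rfl fun γ _ => ?_
  rw [UnitsInt.univ, Finset.sum_pair (by decide)]
  simp [extendHom, mul_add]

theorem extendHom_mem (hB : IsPauliFamily B) {Γ : Type} [CommGroup Γ] (φ : Γ →* Matrix K K ℂ)
    (hφ : ∀ γ, φ γ ∈ signed B) {Q : Matrix K K ℂ} (hQB : Q ∈ signed B)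
    (hQ : Q * Q = 1) (hc : ∀ γ, φ γ * Q = Q * φ γ) (x : Γ × ℤˣ) :
    extendHom φ Q hQ hc x ∈ signed B := by
  obtain ⟨γ, j⟩ := x
  rcases Int.units_eq_one_or j with rfl | rfl
  · simpa [extendHom] using hφ γ
  · simpa [extendHom] using hB.signed_mul_of_commute (hφ γ) hQB (hc γ)

/-- The projector keeps the part of the group commuting with `Q` and then adjoins `Q` to it, as in
the stabilizer update rule. -/
theorem StabPair.measure (hB : IsPauliFamily B) {E h : Matrix K K ℂ} (H : StabPair B E h)
    {Q : Matrix K K ℂ} (hQ : Q ∈ signed B) :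
    StabPair B (((1 / 2 : ℂ) • (1 + Q))ᴴ * E * ((1 / 2 : ℂ) • (1 + Q)))
      (((1 / 2 : ℂ) • (1 + Q))ᴴ * h * ((1 / 2 : ℂ) • (1 + Q))) := by
  have hQ2 := hB.signed_sq hQ
  have hR : Q * ((1 / 2 : ℂ) • (1 + Q)) = (1 / 2 : ℂ) • (1 + Q) := by
    rw [Matrix.mul_smul, mul_add, mul_one, hQ2, add_comm]
  have hherm : ((1 / 2 : ℂ) • (1 + Q))ᴴ = (1 / 2 : ℂ) • (1 + Q) := by
    rw [Matrix.conjTranspose_smul, Matrix.conjTranspose_add, hB.signed_herm hQ]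
    simp
  have hidem : ((1 / 2 : ℂ) • (1 + Q)) * ((1 / 2 : ℂ) • (1 + Q)) = (1 / 2 : ℂ) • (1 + Q) := by
    rw [Matrix.smul_mul, add_mul, one_mul, hR, ← two_smul ℂ, smul_smul]
    norm_num
  obtain ⟨Γ, _, _, φ, a, ha, hφ, hφQ, hE, hh⟩ := H.restrict hB hQ hR
  have hPr : ∀ M : Matrix K K ℂ, M * Q = Q * M →
      ((1 / 2 : ℂ) • (1 + Q)) * M * ((1 / 2 : ℂ) • (1 + Q)) = M * ((1 / 2 : ℂ) • (1 + Q)) := by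
    intro M hM
    have : ((1 / 2 : ℂ) • (1 + Q)) * M = M * ((1 / 2 : ℂ) • (1 + Q)) := by
      rw [Matrix.smul_mul, Matrix.mul_smul, add_mul, mul_add, hM, one_mul, mul_one]
    rw [this, mul_assoc, hidem]
  have hS : ((a : ℂ) • ∑ γ, φ γ) * Q = Q * ((a : ℂ) • ∑ γ, φ γ) := by
    rw [Matrix.smul_mul, Matrix.mul_smul, Finset.sum_mul, Finset.mul_sum]
    exact congrArg _ (Finset.sum_congr rfl fun γ _ => hφQ γ)
  -- If `Q` or `-Q` is already in the image, the extended homomorphism is not injective or contains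
  -- `-1`; the identity holds all the same.
  have hE' : ((a : ℂ) • ∑ γ, φ γ) * ((1 / 2 : ℂ) • (1 + Q)) =
      ((a / 2 : ℝ) : ℂ) • ∑ x, extendHom φ Q hQ2 hφQ x := by
    rw [sum_extendHom, Matrix.smul_mul, Matrix.mul_smul, smul_smul]
    congr 1
    push_cast
    ring
  refine ⟨Γ × ℤˣ, inferInstance, inferInstance, extendHom φ Q hQ2 hφQ, a / 2, by positivity,
    extendHom_mem hB φ hφ hQ hQ2 hφQ, ?_, ?_⟩
  · rw [hE, hherm, hPr _ hS, hE']
  · refine hh.imp id ?_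
    rintro ⟨g, hg, hgφ, hgQ, h'⟩
    refine ⟨g, hg, ?_, ?_⟩
    · rintro ⟨γ, j⟩
      rcases Int.units_eq_one_or j with rfl | rfl
      · simpa [extendHom] using hgφ γ
      · simp only [extendHom, MonoidHom.coe_mk, OneHom.coe_mk]
        rw [if_neg (by decide), ← mul_assoc, hgφ, mul_assoc, hgQ, mul_assoc]
    · rw [h', hE, hherm, hPr _ hS, hPr _ (by rw [mul_assoc, hgQ, ← mul_assoc, hS, mul_assoc]),
        mul_assoc, mul_assoc]
      congr 1
      rw [Matrix.smul_mul, Matrix.mul_smul, add_mul, mul_add, hgQ, one_mul, mul_one]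

/-- Compression of effects by an isometry onto the `+1` eigenspace of a signed Pauli operator. -/
theorem StabPair.compress (hB : IsPauliFamily B) {E h : Matrix K K ℂ} (H : StabPair B E h)
    {K' : Type} [Fintype K'] [DecidableEq K'] {B' : Set (Matrix K' K' ℂ)}
    {Q : Matrix K K ℂ} (hQ : Q ∈ signed B) {R : Matrix K K' ℂ}
    (hR1 : Rᴴ * R = 1) (hR2 : R * Rᴴ = (1 / 2 : ℂ) • (1 + Q))
    (hB' : IsPauliFamily B') (hBB' : ∀ M ∈ signed B, Rᴴ * M * R ∈ signed B' ∨ Rᴴ * M * R = 0) :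
    StabPair B' (Rᴴ * E * R) (Rᴴ * h * R) := by
  have hR : Q * R = R := by
    calc Q * R = Q * (R * Rᴴ) * R := by rw [Matrix.mul_assoc, Matrix.mul_assoc, hR1, Matrix.mul_one]
      _ = (R * Rᴴ) * R := by
          rw [hR2, Matrix.mul_smul, mul_add, mul_one, hB.signed_sq hQ, add_comm]
      _ = R := by rw [Matrix.mul_assoc, hR1, Matrix.mul_one]
  obtain ⟨Γ, _, _, φ, a, ha, hφ, hφQ, hE, hh⟩ := H.restrict hB hQ hR
  have hmul : ∀ M N : Matrix K K ℂ, N * Q = Q * N →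
      Rᴴ * (M * N) * R = (Rᴴ * M * R) * (Rᴴ * N * R) := by
    intro M N hN
    have h1 : (R * Rᴴ) * N * R = N * R := by
      rw [hR2, Matrix.smul_mul, add_mul, ← hN, one_mul, Matrix.smul_mul, Matrix.add_mul,
        Matrix.mul_assoc N, hR, ← two_smul ℂ, smul_smul]
      norm_num
    calc Rᴴ * (M * N) * R = Rᴴ * M * (N * R) := by simp only [Matrix.mul_assoc]
      _ = Rᴴ * M * ((R * Rᴴ) * N * R) := by rw [h1]
      _ = _ := by simp only [Matrix.mul_assoc]
  -- On operators commuting with `Q` compression is multiplicative, so the image squares to one. It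
  -- can vanish only if `1 = 0`, and then it still equals a member of `B'`.
  have hmem : ∀ M ∈ signed B, M * Q = Q * M → Rᴴ * M * R ∈ signed B' := by
    intro M hM hMQ
    rcases hBB' M hM with h1 | h1
    · exact h1
    · have h2 := hmul M M hMQ
      rw [hB.signed_sq hM, Matrix.mul_one, hR1, h1, mul_zero] at h2
      exact h1.trans h2.symm ▸ Or.inl hB'.one_mem
  let ψ : Γ →* Matrix K' K' ℂ :=
    { toFun := fun γ => Rᴴ * φ γ * R
      map_one' := by rw [map_one, Matrix.mul_one, hR1]
      map_mul' := fun x y => by rw [map_mul, hmul _ _ (hφQ y)] }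
  have hψ : Rᴴ * ((a : ℂ) • ∑ γ, φ γ) * R = (a : ℂ) • ∑ γ, ψ γ := by
    rw [Matrix.mul_smul, Matrix.smul_mul, Matrix.mul_sum, Matrix.sum_mul]
    rfl
  refine ⟨Γ, inferInstance, inferInstance, ψ, a, ha, fun γ => hmem _ (hφ γ) (hφQ γ), ?_, ?_⟩
  · rw [hE, hψ]
  · refine hh.imp id ?_
    rintro ⟨g, hg, hgφ, hgQ, h'⟩
    refine ⟨Rᴴ * g * R, hmem g hg hgQ, fun γ => ?_, ?_⟩
    · change _ * (Rᴴ * φ γ * R) = (Rᴴ * φ γ * R) * _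
      rw [← hmul _ _ (hφQ γ), ← hmul _ _ hgQ, hgφ]
    · rw [h', hmul _ _ hgQ, hE]

/-- Transport of effects along a linear map that is multiplicative and preserves signed Pauli
operators. -/
theorem StabPair.map {E h : Matrix K K ℂ} (H : StabPair B E h)
    {K' : Type} [Fintype K'] [DecidableEq K'] {B' : Set (Matrix K' K' ℂ)}
    (F : Matrix K K ℂ →ₐ[ℂ] Matrix K' K' ℂ) (hF : ∀ M ∈ signed B, F M ∈ signed B') :
    StabPair B' (F E) (F h) := by
  obtain ⟨Γ, _, _, φ, a, ha, hφ, rfl, hh⟩ := H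
  refine ⟨Γ, inferInstance, inferInstance, (F : _ →* _).comp φ, a, ha, fun γ => hF _ (hφ γ), ?_, ?_⟩
  · rw [map_smul, map_sum]
    rfl
  · refine hh.imp (fun h0 => by rw [h0, map_zero]) ?_
    rintro ⟨g, hg, hgφ, rfl⟩
    refine ⟨F g, hF g hg, fun γ => ?_, by rw [map_mul]⟩
    simp [← map_mul, hgφ]

end StabPair

/-! ### Pauli strings on a register and on the resource qubits -/

theorem pauliMatrix_family : IsPauliFamily (Set.range pauliMatrix) where
  one_mem := ⟨0, by
    ext i j
    fin_cases i <;> fin_cases j <;> simp [pauliMatrix]⟩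
  herm := by
    rintro _ ⟨s, rfl⟩
    ext i j
    fin_cases s <;> fin_cases i <;> fin_cases j <;> simp [pauliMatrix]
  sq := by
    rintro _ ⟨s, rfl⟩
    ext i j
    fin_cases s <;> fin_cases i <;> fin_cases j <;> simp [pauliMatrix, Matrix.mul_apply]
  mul := by
    rintro _ ⟨s, rfl⟩ _ ⟨t, rfl⟩
    refine ⟨![![0, 0, 0, 0], ![0, 0, 1, 3], ![0, 3, 0, 1], ![0, 1, 3, 0]] s t, pauliMatrix
      (![![0, 1, 2, 3], ![1, 0, 3, 2], ![2, 3, 0, 1], ![3, 2, 1, 0]] s t), ⟨_, rfl⟩, ?_⟩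
    ext i j
    fin_cases s <;> fin_cases t <;> fin_cases i <;> fin_cases j <;>
      simp [pauliMatrix, Matrix.mul_apply, Complex.I_pow_three]
  trace := by
    rintro _ ⟨s, rfl⟩
    by_cases hs : s = 0
    · left
      subst hs
      ext i j
      fin_cases i <;> fin_cases j <;> simp [pauliMatrix]
    · right
      fin_cases s <;> simp_all [pauliMatrix, Matrix.trace]

theorem pauliMatrix_zero : pauliMatrix 0 = 1 := by
  ext i j
  fin_cases i <;> fin_cases j <;> simp [pauliMatrix]

/-- The Pauli strings on `n` qubits. -/
def pauliStrings (n : ℕ) : Set (Op n) := Set.range pauliString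

theorem pauliString_eq_piMat {n : ℕ} (s : Fin n → Fin 4) :
    pauliString s = piMat fun i => pauliMatrix (s i) := rfl

theorem pauliStrings_family (n : ℕ) : IsPauliFamily (pauliStrings n) := by
  have h := pauliMatrix_family.pi (ι := Fin n)
  convert h using 1
  ext M
  constructor
  · rintro ⟨s, rfl⟩
    exact ⟨fun i => pauliMatrix (s i), fun i => ⟨s i, rfl⟩, rfl⟩
  · rintro ⟨A, hA, rfl⟩
    choose s hs using hA
    exact ⟨s, by rw [pauliString_eq_piMat]; simp only [hs]⟩

/-- The labels of the computational basis of `N` systems of `r` qubits. -/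
abbrev Copies (r N : ℕ) : Type := Fin N → Qubits r

/-- The Pauli strings on `N` systems of `r` qubits. -/
def copyPaulis (r N : ℕ) : Set (Matrix (Copies r N) (Copies r N) ℂ) :=
  {M | ∃ A : Fin N → Op r, (∀ j, A j ∈ pauliStrings r) ∧ M = piMat A}

theorem copyPaulis_family (r N : ℕ) : IsPauliFamily (copyPaulis r N) := (pauliStrings_family r).pi

/-- The Pauli strings on a register of `n` qubits together with `N` systems of `r` qubits. -/
def jointPaulis (n r N : ℕ) : Set (Matrix (Qubits n × Copies r N) (Qubits n × Copies r N) ℂ) :=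
  {M | ∃ P ∈ pauliStrings n, ∃ Q ∈ copyPaulis r N, M = P ⊗ₖ Q}

theorem jointPaulis_family (n r N : ℕ) : IsPauliFamily (jointPaulis n r N) :=
  (pauliStrings_family n).kronecker (copyPaulis_family r N)

/-! ### Effects of the branches of a protocol -/

/-- `N` copies of the state `|Ψ⟩⟨Ψ|`. -/
def copyState {r : ℕ} (Ψ : Ket r) (N : ℕ) : Matrix (Copies r N) (Copies r N) ℂ :=
  piMat fun _ => Matrix.vecMulVec Ψ (star Ψ)

/-- The functionals `f` and `g` are given by effects of a post-selected stabilizer circuit that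
acts on a register of `n` qubits and `N` copies of `Ψ`. -/
def IsStabEffect {r : ℕ} (Ψ : Ket r) {n : ℕ} (N : ℕ) (f g : Op n → ℂ) : Prop :=
  ∃ E h, StabPair (jointPaulis n r N) E h ∧
    (∀ ρ, f ρ = (E * (ρ ⊗ₖ copyState Ψ N)).trace) ∧
    (∀ ρ, g ρ = (h * (ρ ⊗ₖ copyState Ψ N)).trace)

theorem signed_kronecker_one {n r N : ℕ} {P : Op n} (h : P ∈ signed (pauliStrings n)) :
    P ⊗ₖ (1 : Matrix (Copies r N) (Copies r N) ℂ) ∈ signed (jointPaulis n r N) := by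
  rcases h with h | h
  · exact Or.inl ⟨P, h, 1, (copyPaulis_family r N).one_mem, rfl⟩
  · refine Or.inr ⟨-P, h, 1, (copyPaulis_family r N).one_mem, ?_⟩
    ext i j
    simp [Matrix.kroneckerMap_apply]

/-- Passage to the Heisenberg picture: an operation on the register becomes a sandwich of the
effect. -/
theorem trace_conj_kronecker {n m : ℕ} {L : Type} [Fintype L] [DecidableEq L]
    (E : Matrix (Qubits m × L) (Qubits m × L) ℂ) (K : Matrix (Qubits m) (Qubits n) ℂ) (ρ : Op n)
    (X : Matrix L L ℂ) :
    (E * ((K * ρ * Kᴴ) ⊗ₖ X)).trace =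
      (((K ⊗ₖ (1 : Matrix L L ℂ))ᴴ * E * (K ⊗ₖ (1 : Matrix L L ℂ))) * (ρ ⊗ₖ X)).trace := by
  have h : (K * ρ * Kᴴ) ⊗ₖ X = (K ⊗ₖ (1 : Matrix L L ℂ)) * (ρ ⊗ₖ X) *
      (K ⊗ₖ (1 : Matrix L L ℂ))ᴴ := by
    rw [Matrix.conjTranspose_kronecker, ← Matrix.mul_kronecker_mul, ← Matrix.mul_kronecker_mul]
    simp
  rw [h, ← Matrix.mul_assoc, Matrix.trace_mul_comm, ← Matrix.mul_assoc, ← Matrix.mul_assoc]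

/-- `IsClifford` speaks of `V * P * Vᴴ`, while effects are pulled back by `Vᴴ * P * V`. Conjugation
by `V` is an injective self-map of the finite set of signed Pauli strings, hence surjective, so its
inverse preserves the set too. -/
theorem conj_signed_of_isClifford {n : ℕ} {V : Op n} (hV : IsClifford V) {P : Op n}
    (hP : P ∈ signed (pauliStrings n)) : Vᴴ * P * V ∈ signed (pauliStrings n) := by
  have h1 : Vᴴ * V = 1 := Matrix.mem_unitaryGroup_iff'.mp hV.1
  have hfin : (signed (pauliStrings n)).Finite := by
    have hf : (pauliStrings n).Finite := Set.finite_range _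
    refine (hf.union (hf.image Neg.neg)).subset ?_
    rintro M (h | h)
    · exact Or.inl h
    · exact Or.inr ⟨-M, h, neg_neg M⟩
  have hmaps : Set.MapsTo (fun M => V * M * Vᴴ) (signed (pauliStrings n))
      (signed (pauliStrings n)) := by
    rintro M (⟨s, rfl⟩ | ⟨s, h⟩)
    · obtain ⟨t, ht | ht⟩ := hV.2 s
      · exact Or.inl ⟨t, ht.symm⟩
      · exact Or.inr ⟨t, by beta_reduce; rw [ht, neg_neg]⟩
    · obtain ⟨t, ht | ht⟩ := hV.2 s
      · exact Or.inr ⟨t, by rw [← ht, h]; simp⟩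
      · refine Or.inl ⟨t, ?_⟩
        rw [h, Matrix.mul_neg, Matrix.neg_mul, neg_inj] at ht
        exact ht.symm
  have hinj : Set.InjOn (fun M => V * M * Vᴴ) (signed (pauliStrings n)) := by
    intro M _ M' _ (h : V * M * Vᴴ = V * M' * Vᴴ)
    have := congrArg (fun X => Vᴴ * X * V) h
    simpa only [← Matrix.mul_assoc, h1, Matrix.one_mul, Matrix.mul_assoc _ Vᴴ V,
      Matrix.mul_one] using this
  have := hfin.to_subtype
  obtain ⟨⟨M, hM⟩, h⟩ := Finite.surjective_of_injective (f := hmaps.restrict _ _ _)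
    (hmaps.restrict_inj.mpr hinj) ⟨P, hP⟩
  have hMP : V * M * Vᴴ = P := congrArg Subtype.val h
  rw [← hMP, ← Matrix.mul_assoc, ← Matrix.mul_assoc, h1, Matrix.one_mul, Matrix.mul_assoc, h1,
    Matrix.mul_one]
  exact hM

theorem IsStabEffect.smul {r : ℕ} {Ψ : Ket r} {n N : ℕ} {f g : Op n → ℂ}
    (H : IsStabEffect Ψ N f g) {c : ℝ} (hc : 0 ≤ c) :
    IsStabEffect Ψ N (fun ρ => c * f ρ) (fun ρ => c * g ρ) := by
  obtain ⟨E, h, hs, hf, hg⟩ := H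
  refine ⟨_, _, hs.smul hc, fun ρ => ?_, fun ρ => ?_⟩
  · beta_reduce
    rw [hf, Matrix.smul_mul, Matrix.trace_smul, smul_eq_mul]
  · beta_reduce
    rw [hg, Matrix.smul_mul, Matrix.trace_smul, smul_eq_mul]

theorem IsStabEffect.clifford {r : ℕ} {Ψ : Ket r} {n N : ℕ} {f g : Op n → ℂ}
    (H : IsStabEffect Ψ N f g) {V : Op n} (hV : IsClifford V) :
    IsStabEffect Ψ N (fun ρ => f (conjBy V ρ)) (fun ρ => g (conjBy V ρ)) := by
  obtain ⟨E, h, hs, hf, hg⟩ := H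
  have h1 : Vᴴ * V = 1 := Matrix.mem_unitaryGroup_iff'.mp hV.1
  have h2 : V * Vᴴ = 1 := Matrix.mem_unitaryGroup_iff.mp hV.1
  -- A unitary is the case `Q = 1` of a compression, where the projector `(1 + Q) / 2` is the
  -- identity.
  refine ⟨_, _, hs.compress (jointPaulis_family n r N) (Q := 1)
    (Or.inl (jointPaulis_family n r N).one_mem)
    (R := V ⊗ₖ (1 : Matrix (Copies r N) (Copies r N) ℂ)) ?_ ?_ (jointPaulis_family n r N) ?_,
    fun ρ => ?_, fun ρ => ?_⟩
  · rw [Matrix.conjTranspose_kronecker, ← Matrix.mul_kronecker_mul, h1]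
    simp
  · rw [Matrix.conjTranspose_kronecker, ← Matrix.mul_kronecker_mul, h2, ← two_smul ℂ, smul_smul]
    simp
  · intro M hM
    left
    have key : ∀ P ∈ pauliStrings n, ∀ Q ∈ copyPaulis r N,
        (V ⊗ₖ (1 : Matrix (Copies r N) (Copies r N) ℂ))ᴴ * (P ⊗ₖ Q) * (V ⊗ₖ 1) ∈
          signed (jointPaulis n r N) := by
      intro P hP Q hQ
      rw [Matrix.conjTranspose_kronecker, ← Matrix.mul_kronecker_mul, ← Matrix.mul_kronecker_mul,
        Matrix.conjTranspose_one, Matrix.one_mul, Matrix.mul_one]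
      rcases conj_signed_of_isClifford hV (Or.inl hP) with h | h
      · exact Or.inl ⟨_, h, Q, hQ, rfl⟩
      · refine Or.inr ⟨_, h, Q, hQ, ?_⟩
        ext i j
        simp [Matrix.kroneckerMap_apply]
    rcases hM with ⟨P, hP, Q, hQ, rfl⟩ | ⟨P, hP, Q, hQ, hM⟩
    · exact key P hP Q hQ
    · have := key P hP Q hQ
      rw [← hM, Matrix.mul_neg, Matrix.neg_mul] at this
      rcases this with h | h
      · exact Or.inr h
      · exact Or.inl (by rwa [neg_neg] at h)
  · exact (hf _).trans <| trace_conj_kronecker _ _ _ _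
  · exact (hg _).trans <| trace_conj_kronecker _ _ _ _

theorem IsStabEffect.measure {r : ℕ} {Ψ : Ket r} {n N : ℕ} {f g : Op n → ℂ}
    (H : IsStabEffect Ψ N f g) (s : Fin n → Fin 4) (o : Bool) :
    IsStabEffect Ψ N (fun ρ => f (conjBy (pauliProjector s o) ρ))
      (fun ρ => g (conjBy (pauliProjector s o) ρ)) := by
  obtain ⟨E, h, hs, hf, hg⟩ := H
  have hQ : (if o then (-1 : ℂ) else 1) • pauliString s ∈ signed (pauliStrings n) := by
    cases o
    · exact Or.inl ⟨s, by simp⟩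
    · exact Or.inr ⟨s, by simp⟩
  have hP : (1 / 2 : ℂ) • (1 + ((if o then (-1 : ℂ) else 1) • pauliString s) ⊗ₖ
      (1 : Matrix (Copies r N) (Copies r N) ℂ)) = pauliProjector s o ⊗ₖ 1 := by
    unfold pauliProjector
    generalize (if o then (-1 : ℂ) else 1) • pauliString s = Q
    rw [Matrix.smul_kronecker, Matrix.add_kronecker, Matrix.one_kronecker_one]
  have := hs.measure (jointPaulis_family n r N) (signed_kronecker_one hQ)
  rw [hP] at this
  refine ⟨_, _, this, fun ρ => ?_, fun ρ => ?_⟩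
  · exact (hf _).trans <| trace_conj_kronecker _ _ _ _
  · exact (hg _).trans <| trace_conj_kronecker _ _ _ _

/-! ### Appending states: registers split into `n` and `r` qubits -/

theorem appendKet_append {n r : ℕ} (Ψ : Ket r) (b b' : Qubits n) (c : Qubits r) :
    appendKet n Ψ (Fin.append b c) b' = if b = b' then Ψ c else 0 := by
  simp [appendKet]

theorem sum_qubits_add {n r : ℕ} (F : Qubits (n + r) → ℂ) :
    ∑ a, F a = ∑ b : Qubits n, ∑ c : Qubits r, F (Fin.append b c) := by
  rw [← (Fin.appendEquiv (α := Fin 2) n r).sum_comp, Fintype.sum_prod_type]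
  rfl

theorem pauliString_append {n r : ℕ} (s : Fin (n + r) → Fin 4) (b b' : Qubits n)
    (c c' : Qubits r) :
    pauliString s (Fin.append b c) (Fin.append b' c') =
      pauliString (fun i => s (Fin.castAdd r i)) b b' *
        pauliString (fun j => s (Fin.natAdd n j)) c c' := by
  simp [pauliString, Fin.prod_univ_add]

theorem conj_appendKet_append {n r : ℕ} (Ψ : Ket r) (ρ : Op n) (b b' : Qubits n)
    (c c' : Qubits r) :
    (appendKet n Ψ * ρ * (appendKet n Ψ)ᴴ) (Fin.append b c) (Fin.append b' c') =
      ρ b b' * (Ψ c * star (Ψ c')) := by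
  simp [Matrix.mul_apply, appendKet_append, apply_ite]
  ring

theorem compress_appendKet {n r : ℕ} (Ψ : Ket r) (M : Op (n + r)) (b b' : Qubits n) :
    ((appendKet n Ψ)ᴴ * M * appendKet n Ψ) b b' =
      ∑ c', ∑ c, star (Ψ c) * M (Fin.append b c) (Fin.append b' c') * Ψ c' := by
  simp [Matrix.mul_apply, sum_qubits_add, appendKet_append, apply_ite, Finset.sum_mul]

theorem eq_of_append_eq {n r : ℕ} {M M' : Op (n + r)}
    (h : ∀ b b' c c', M (Fin.append b c) (Fin.append b' c') =
      M' (Fin.append b c) (Fin.append b' c')) : M = M' := by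
  ext a a'
  have := h (fun i => a (Fin.castAdd r i)) (fun i => a' (Fin.castAdd r i))
    (fun i => a (Fin.natAdd n i)) (fun i => a' (Fin.natAdd n i))
  rwa [Fin.append_castAdd_natAdd, Fin.append_castAdd_natAdd] at this

theorem ketZero_apply (c : Qubits 1) : ketZero c = if c = 0 then 1 else 0 := by
  have : c = 0 ↔ c 0 = 0 := by simp [funext_iff]
  simp [ketZero, this]

theorem compress_appendKet_ketZero {n : ℕ} (M : Op (n + 1)) (b b' : Qubits n) :
    ((appendKet n ketZero)ᴴ * M * appendKet n ketZero) b b' =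
      M (Fin.append b 0) (Fin.append b' 0) := by
  simp [compress_appendKet, ketZero_apply, apply_ite]

theorem pauliString_zero (n : ℕ) : pauliString (fun _ : Fin n => 0) = 1 := by
  rw [pauliString_eq_piMat]
  simp only [pauliMatrix_zero]
  exact piMat_one

/-- The Pauli string `Z` on the last qubit. -/
def lastZ (n : ℕ) : Op (n + 1) := pauliString (Fin.append (fun _ : Fin n => 0) fun _ : Fin 1 => 3)

theorem appendKet_ketZero_mul_conjTranspose (n : ℕ) :
    appendKet n ketZero * (appendKet n ketZero)ᴴ = (1 / 2 : ℂ) • (1 + lastZ n) := by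
  refine eq_of_append_eq fun b b' c c' => ?_
  have h := conj_appendKet_append ketZero (1 : Op n) b b' c c'
  rw [Matrix.mul_one] at h
  rw [h, ← pauliString_zero (n + 1), Matrix.smul_apply, Matrix.add_apply, pauliString_append, lastZ,
    pauliString_append]
  simp only [Fin.append_left, Fin.append_right, pauliString_zero]
  rw [← mul_add, ketZero, ketZero]
  simp only [pauliString, Matrix.of_apply, Fin.prod_univ_one, pauliMatrix]
  generalize hx : c 0 = x
  generalize hy : c' 0 = y
  have hcc : (c = c') ↔ x = y := by
    rw [← hx, ← hy]
    simp [funext_iff]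
  simp only [Matrix.one_apply, hcc]
  fin_cases x <;> fin_cases y <;> (simp; try norm_num)

theorem appendKet_isometry {n r : ℕ} {Ψ : Ket r} (hΨ : ∑ c, star (Ψ c) * Ψ c = 1) :
    (appendKet n Ψ)ᴴ * appendKet n Ψ = 1 := by
  ext b b'
  simp only [Matrix.mul_apply, sum_qubits_add, appendKet_append, Matrix.conjTranspose_apply,
    Matrix.one_apply]
  rw [Finset.sum_eq_single b (fun x _ hx => by simp [hx]) (by simp)]
  by_cases h : b = b'
  · simpa [h] using hΨ
  · simp [h]

theorem sum_ketZero : ∑ c, star (ketZero c) * ketZero c = 1 := by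
  simp [ketZero_apply, apply_ite]

theorem IsStabEffect.ancilla {r : ℕ} {Ψ : Ket r} {n N : ℕ} {f g : Op (n + 1) → ℂ}
    (H : IsStabEffect Ψ N f g) :
    IsStabEffect Ψ N (fun ρ => f (conjBy (appendKet n ketZero) ρ))
      (fun ρ => g (conjBy (appendKet n ketZero) ρ)) := by
  obtain ⟨E, h, hs, hf, hg⟩ := H
  refine ⟨_, _, hs.compress (jointPaulis_family (n + 1) r N) (Q := lastZ n ⊗ₖ (1 : Matrix (Copies r N) (Copies r N) ℂ))
    (signed_kronecker_one (Or.inl ⟨_, rfl⟩))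
    (R := appendKet n ketZero ⊗ₖ (1 : Matrix (Copies r N) (Copies r N) ℂ)) ?_ ?_
    (jointPaulis_family n r N) ?_, fun ρ => (hf _).trans <| trace_conj_kronecker _ _ _ _,
    fun ρ => (hg _).trans <| trace_conj_kronecker _ _ _ _⟩
  · rw [Matrix.conjTranspose_kronecker, ← Matrix.mul_kronecker_mul,
      appendKet_isometry sum_ketZero]
    simp
  · rw [Matrix.conjTranspose_kronecker, ← Matrix.mul_kronecker_mul,
      appendKet_ketZero_mul_conjTranspose, Matrix.smul_kronecker, Matrix.add_kronecker]
    simp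
  · have key : ∀ P ∈ pauliStrings (n + 1), ∀ Q ∈ copyPaulis r N,
        (appendKet n ketZero ⊗ₖ (1 : Matrix (Copies r N) (Copies r N) ℂ))ᴴ * (P ⊗ₖ Q) *
            (appendKet n ketZero ⊗ₖ (1 : Matrix (Copies r N) (Copies r N) ℂ)) ∈ jointPaulis n r N ∨
          (appendKet n ketZero ⊗ₖ (1 : Matrix (Copies r N) (Copies r N) ℂ))ᴴ * (P ⊗ₖ Q) *
            (appendKet n ketZero ⊗ₖ (1 : Matrix (Copies r N) (Copies r N) ℂ)) = 0 := by
      rintro _ ⟨s, rfl⟩ Q hQ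
      rw [Matrix.conjTranspose_kronecker, ← Matrix.mul_kronecker_mul, ← Matrix.mul_kronecker_mul,
        Matrix.conjTranspose_one, Matrix.one_mul, Matrix.mul_one]
      have hP : (appendKet n ketZero)ᴴ * pauliString s * appendKet n ketZero =
          pauliMatrix (s (Fin.last n)) 0 0 • pauliString fun i => s i.castSucc := by
        ext b b'
        rw [compress_appendKet_ketZero, pauliString_append, Matrix.smul_apply, smul_eq_mul, mul_comm]
        congr 1
        simp [pauliString]
        rfl
      rw [hP]
      generalize s (Fin.last n) = x
      -- The ancilla sees only `⟨0|P|0⟩`, which is one for `I, Z` and zero for `X, Y`.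
      have hx : pauliMatrix x 0 0 = 1 ∨ pauliMatrix x 0 0 = 0 := by
        fin_cases x <;> simp [pauliMatrix]
      rcases hx with hx | hx
      · left
        rw [hx, one_smul]
        exact ⟨_, ⟨_, rfl⟩, Q, hQ, rfl⟩
      · right
        rw [hx, zero_smul, Matrix.zero_kronecker]
    rintro M (⟨P, hP, Q, hQ, rfl⟩ | ⟨P, hP, Q, hQ, hM⟩)
    · exact (key P hP Q hQ).imp_left Or.inl
    · have := key P hP Q hQ
      rw [← hM, Matrix.mul_neg, Matrix.neg_mul, neg_eq_zero] at this
      exact this.imp_left Or.inr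

/-- Moves the last `r` qubits of a register to the resource qubits. -/
def resourceEquiv (n r N : ℕ) : Qubits (n + r) × Copies r N ≃ Qubits n × Copies r (N + 1) :=
  ((Fin.appendEquiv n r).symm.prodCongr (Equiv.refl _)).trans
    ((Equiv.prodAssoc _ _ _).trans
      ((Equiv.refl _).prodCongr (Fin.consEquiv fun _ => Qubits r)))

theorem resourceEquiv_symm_apply (n r N : ℕ) (b : Qubits n) (a : Copies r (N + 1)) :
    (resourceEquiv n r N).symm (b, a) = (Fin.append b (a 0), Fin.tail a) := rfl

/-- Unlike the ancilla, `Ψ` is not absorbed into the effect: its qubits are only relabelled as one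
more copy, so the effect stays a sum of Pauli operators and `N` counts the copies. -/
theorem IsStabEffect.resource {r : ℕ} {Ψ : Ket r} {n N : ℕ} {f g : Op (n + r) → ℂ}
    (H : IsStabEffect Ψ N f g) :
    IsStabEffect Ψ (N + 1) (fun ρ => f (conjBy (appendKet n Ψ) ρ))
      (fun ρ => g (conjBy (appendKet n Ψ) ρ)) := by
  obtain ⟨E, h, hs, hf, hg⟩ := H
  have htr : ∀ (M : Matrix (Qubits (n + r) × Copies r N) (Qubits (n + r) × Copies r N) ℂ)
      (ρ : Op n), (M * ((appendKet n Ψ * ρ * (appendKet n Ψ)ᴴ) ⊗ₖ copyState Ψ N)).trace =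
        (Matrix.reindexAlgEquiv ℂ ℂ (resourceEquiv n r N) M * (ρ ⊗ₖ copyState Ψ (N + 1))).trace := by
    intro M ρ
    have h1 : ρ ⊗ₖ copyState Ψ (N + 1) = Matrix.reindexAlgEquiv ℂ ℂ (resourceEquiv n r N)
        ((appendKet n Ψ * ρ * (appendKet n Ψ)ᴴ) ⊗ₖ copyState Ψ N) := by
      ext ⟨b, a⟩ ⟨b', a'⟩
      simp only [Matrix.coe_reindexAlgEquiv, Matrix.reindex_apply, Matrix.submatrix_apply,
        resourceEquiv_symm_apply, Matrix.kroneckerMap_apply, conj_appendKet_append, copyState,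
        piMat_apply, Fin.prod_univ_succ, Matrix.vecMulVec_apply, Pi.star_apply, Fin.tail]
      ring
    rw [h1, ← map_mul]
    generalize M * _ = M'
    exact ((resourceEquiv n r N).symm.sum_comp fun x => M' x x).symm
  refine ⟨_, _, hs.map (B' := jointPaulis n r (N + 1))
    (Matrix.reindexAlgEquiv ℂ ℂ (resourceEquiv n r N)).toAlgHom ?_,
    fun ρ => (hf _).trans (htr _ ρ), fun ρ => (hg _).trans (htr _ ρ)⟩
  have key : ∀ M ∈ jointPaulis (n + r) r N,
      Matrix.reindexAlgEquiv ℂ ℂ (resourceEquiv n r N) M ∈ jointPaulis n r (N + 1) := by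
    rintro _ ⟨_, ⟨s, rfl⟩, _, ⟨A, hA, rfl⟩, rfl⟩
    refine ⟨pauliString fun i => s (Fin.castAdd r i), ⟨_, rfl⟩,
      piMat (Fin.cons (pauliString fun j => s (Fin.natAdd n j)) A), ⟨_, ?_, rfl⟩, ?_⟩
    · refine Fin.cases ?_ fun j => ?_
      · exact ⟨_, rfl⟩
      · exact hA j
    · ext ⟨b, a⟩ ⟨b', a'⟩
      simp only [Matrix.coe_reindexAlgEquiv, Matrix.reindex_apply, Matrix.submatrix_apply,
        resourceEquiv_symm_apply, Matrix.kroneckerMap_apply, pauliString_append, piMat_apply,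
        Fin.prod_univ_succ, Fin.cons_zero, Fin.cons_succ, Fin.tail, mul_assoc]
  rintro M (hM | hM)
  · exact Or.inl (key M hM)
  · right
    rw [← map_neg]
    exact key _ hM

/-- Duality of the partial trace: a Pauli on the output qubit pulls back to the same Pauli padded
with identities. -/
theorem trace_reduceTo {n : ℕ} (i : Fin n) (s : Fin 4) (ρ : Op n) :
    (pauliMatrix s * reduceTo i ρ).trace =
      (pauliString (Function.update (fun _ => 0) i s) * ρ).trace := by
  have h1 : (pauliMatrix s * reduceTo i ρ).trace =
      ∑ a : Qubits n, ∑ x, pauliMatrix s x (a i) * ρ a (Function.update a i x) := by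
    simp only [Matrix.trace, Matrix.diag_apply, Matrix.mul_apply, reduceTo, LinearMap.coe_mk,
      AddHom.coe_mk, Matrix.of_apply, Finset.mul_sum, mul_ite, mul_zero]
    rw [Finset.sum_comm (s := (Finset.univ : Finset (Qubits n)))]
    refine Finset.sum_congr rfl fun x _ => ?_
    rw [Finset.sum_comm]
    simp
  rw [h1]
  simp only [Matrix.trace, Matrix.diag_apply, Matrix.mul_apply]
  conv_rhs => rw [Finset.sum_comm]
  refine Finset.sum_congr rfl fun a _ => ?_
  refine Fintype.sum_of_injective (fun x : Fin 2 => (Function.update a i x : Qubits n))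
    (Function.update_injective a i) (fun x => pauliMatrix s x (a i) * ρ a (Function.update a i x))
    (fun b => pauliString (Function.update (fun _ => 0) i s) b a * ρ a b) (fun b hb => ?_)
    fun x => ?_
  · have hab : ∃ j, j ≠ i ∧ b j ≠ a j := by
      by_contra! hc
      refine hb ⟨b i, ?_⟩
      ext j
      by_cases hj : j = i
      · subst hj; simp
      · simp [hj, hc j hj]
    obtain ⟨j, hj, hne⟩ := hab
    rw [pauliString, Matrix.of_apply, Finset.prod_eq_zero (Finset.mem_univ j), zero_mul]
    rw [Function.update_of_ne hj, pauliMatrix_zero, Matrix.one_apply_ne hne]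
  · congr 1
    rw [pauliString, Matrix.of_apply, Fintype.prod_eq_single i]
    · simp
    · intro j hj
      rw [Function.update_of_ne hj, Function.update_of_ne hj, pauliMatrix_zero, Matrix.one_apply_eq]

theorem IsStabEffect.output {r : ℕ} (Ψ : Ket r) {n : ℕ} (i : Fin n) (s : Fin 4) :
    IsStabEffect Ψ 0 (fun ρ => (reduceTo i ρ).trace)
      (fun ρ => (pauliMatrix s * reduceTo i ρ).trace) := by
  have h0 : ∀ (M ρ : Op n), (M * ρ).trace =
      ((M ⊗ₖ (1 : Matrix (Copies r 0) (Copies r 0) ℂ)) * (ρ ⊗ₖ copyState Ψ 0)).trace := by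
    intro M ρ
    have : copyState Ψ 0 = 1 := by
      ext a b
      rw [Subsingleton.elim a b]
      simp [copyState, piMat_apply]
    rw [← Matrix.mul_kronecker_mul, Matrix.trace_kronecker, this]
    simp
  have h1 : ∀ ρ : Op n, (reduceTo i ρ).trace = ((1 : Op n) * ρ).trace := by
    intro ρ
    have := trace_reduceTo i 0 ρ
    rwa [pauliMatrix_zero, Matrix.one_mul, Function.update_eq_self_iff.mpr rfl,
      pauliString_zero] at this
  refine ⟨1 ⊗ₖ 1, pauliString (Function.update (fun _ => 0) i s) ⊗ₖ 1,
    ⟨Unit, inferInstance, inferInstance, 1, 1, zero_le_one, fun _ => ?_, ?_, Or.inr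
      ⟨pauliString (Function.update (fun _ => 0) i s) ⊗ₖ 1,
        signed_kronecker_one (Or.inl ⟨_, rfl⟩), fun _ => by simp, by simp⟩⟩, fun ρ => ?_, fun ρ => ?_⟩
  · exact Or.inl (jointPaulis_family n r 0).one_mem
  · simp
  · exact (h1 ρ).trans (h0 1 ρ)
  · exact (trace_reduceTo i s ρ).trans (h0 _ ρ)

/-- Induction backwards from the output, each step of the protocol pulling both effects back at
once. -/
theorem Protocol.isStabEffect_branches {r : ℕ} {Ψ : Ket r} (s : Fin 4) {n : ℕ}
    (π : Protocol Ψ n) : ∀ b ∈ π.branches, IsStabEffect Ψ b.consumed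
      (fun ρ => (b.run ρ).trace) (fun ρ => (pauliMatrix s * b.run ρ).trace) := by
  induction π with
  | output i =>
    intro b hb
    rw [Protocol.branches, List.mem_singleton] at hb
    subst hb
    exact IsStabEffect.output Ψ i s
  | clifford V hV next ih =>
    intro b hb
    obtain ⟨b', hb', rfl⟩ := List.mem_map.mp hb
    exact (ih b' hb').clifford hV
  | ancilla next ih =>
    intro b hb
    obtain ⟨b', hb', rfl⟩ := List.mem_map.mp hb
    exact (ih b' hb').ancilla
  | measure t next ih =>
    intro b hb
    rcases List.mem_append.mp hb with hb | hb <;> obtain ⟨b', hb', rfl⟩ := List.mem_map.mp hb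
    · exact (ih false b' hb').measure t false
    · exact (ih true b' hb').measure t true
  | random p hp next ih =>
    intro b hb
    rcases List.mem_append.mp hb with hb | hb <;> obtain ⟨b', hb', rfl⟩ := List.mem_map.mp hb
    · simpa using (ih false b' hb').smul (sub_nonneg.mpr hp.2)
    · simpa using (ih true b' hb').smul hp.1
  | resource next ih =>
    intro b hb
    obtain ⟨b', hb', rfl⟩ := List.mem_map.mp hb
    exact (ih b' hb').resource

/-! ### Lower bounds on the probabilities of stabilizer projections -/

theorem exists_nat_trace_of_idempotent {K : Type} [Fintype K] [DecidableEq K] {P : Matrix K K ℂ}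
    (hP : P * P = P) : ∃ R : ℕ, P.trace = R := by
  have h : IsIdempotentElem (Matrix.toLin' P) := by
    change Matrix.toLin' P * Matrix.toLin' P = _
    rw [Module.End.mul_eq_comp, ← Matrix.toLin'_mul, hP]
  refine ⟨Module.finrank ℂ (LinearMap.range (Matrix.toLin' P)), ?_⟩
  rw [← LinearMap.IsProj.trace (LinearMap.IsIdempotentElem.isProj_range _ h), Matrix.trace_toLin'_eq]

/-- Up to a natural number `R`, the sum over a group of signed Pauli operators is a sum over
distinct operators, and its normalization only depends on the dimension. -/
theorem IsPauliFamily.sum_group {K : Type} [Fintype K] [DecidableEq K]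
    {B : Set (Matrix K K ℂ)} (hB : IsPauliFamily B) {Γ : Type} [CommGroup Γ] [Fintype Γ]
    (φ : Γ →* Matrix K K ℂ) (hφ : ∀ γ, φ γ ∈ signed B) :
    ∃ (R : ℕ) (G : Finset (Matrix K K ℂ)), (∀ g ∈ G, g ∈ signed B) ∧
      (Fintype.card K : ℂ) • ∑ γ, φ γ = ((Fintype.card Γ * R : ℕ) : ℂ) • ∑ g ∈ G, g := by
  classical
  have habs : ∀ γ, φ γ * ∑ γ, φ γ = ∑ γ, φ γ := by
    intro γ
    rw [Finset.mul_sum, ← Equiv.sum_comp (Equiv.mulLeft γ) φ]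
    simp
  -- If `-1` is in the image, the group sum equals its own negative and vanishes, so `R = 0` works.
  by_cases hneg : ∃ γ, φ γ = -1
  · obtain ⟨γ, hγ⟩ := hneg
    have h := habs γ
    rw [hγ, neg_one_mul] at h
    have h0 : ∑ γ, φ γ = 0 := by
      ext i j
      exact self_eq_neg.mp (congrFun (congrFun h i) j).symm
    exact ⟨0, ∅, by simp, by simp [h0]⟩
  push Not at hneg
  set κ : ℕ := (Finset.univ.filter fun γ => φ γ = 1).card with hκ
  have hΓ : (Fintype.card Γ : ℂ) ≠ 0 := by
    exact_mod_cast Fintype.card_ne_zero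
  have htr : (∑ γ, φ γ).trace = κ * Fintype.card K := by
    rw [Matrix.trace_sum, hκ, Finset.card_filter]
    push_cast
    rw [Finset.sum_mul]
    refine Finset.sum_congr rfl fun γ _ => ?_
    split_ifs with h
    · rw [h, Matrix.trace_one, one_mul]
    · rw [((hB.signed_trace (hφ γ)).resolve_left h).resolve_left (hneg γ), zero_mul]
  -- The average over the group is idempotent, so its trace is a rank. Only the kernel, of order
  -- `κ`, contributes to the trace, which gives `κ * card K = card Γ * R`.
  obtain ⟨R, hR⟩ : ∃ R : ℕ, ((Fintype.card Γ : ℂ)⁻¹ • ∑ γ, φ γ).trace = R := by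
    refine exists_nat_trace_of_idempotent ?_
    rw [Matrix.smul_mul, Finset.sum_mul]
    simp only [Matrix.mul_smul, habs]
    rw [Finset.sum_const, Finset.card_univ, ← Nat.cast_smul_eq_nsmul ℂ, smul_smul,
      inv_mul_cancel₀ hΓ, one_smul]
  rw [Matrix.trace_smul, htr, smul_eq_mul, inv_mul_eq_iff_eq_mul₀ hΓ] at hR
  refine ⟨R, Finset.univ.image φ, ?_, ?_⟩
  · intro g hg
    obtain ⟨γ, _, rfl⟩ := Finset.mem_image.mp hg
    exact hφ γ
  -- All nonempty fibres of `φ` are cosets of the kernel.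
  · have hS : ∑ γ, φ γ = (κ : ℂ) • ∑ g ∈ Finset.univ.image φ, g := by
      rw [← Finset.sum_fiberwise_of_maps_to (t := Finset.univ.image φ) (g := φ)
        (fun γ _ => Finset.mem_image_of_mem _ (Finset.mem_univ γ)), Finset.smul_sum]
      refine Finset.sum_congr rfl fun g hg => ?_
      obtain ⟨γ₀, _, rfl⟩ := Finset.mem_image.mp hg
      rw [Finset.sum_congr rfl (fun γ hγ => (Finset.mem_filter.mp hγ).2), Finset.sum_const,
        ← Nat.cast_smul_eq_nsmul ℂ, hκ]
      congr 2
      refine Finset.card_bij (fun γ _ => γ * γ₀⁻¹) ?_ ?_ ?_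
      · intro γ hγ
        simp only [Finset.mem_filter, Finset.mem_univ, true_and] at hγ ⊢
        rw [map_mul, hγ, ← map_mul, mul_inv_cancel, map_one]
      · intro γ _ γ' _ h
        exact mul_right_cancel h
      · intro γ hγ
        simp only [Finset.mem_filter, Finset.mem_univ, true_and] at hγ
        exact ⟨γ * γ₀, by simp [hγ], by simp⟩
    rw [hS, smul_smul, mul_comm (Fintype.card K : ℂ), hR, Nat.cast_mul]

/-- The value of an effect on `N` copies of `Ψ`. -/
def copyValue {r : ℕ} (Ψ : Ket r) (N : ℕ)
    (M : Matrix (Qubits 0 × Copies r N) (Qubits 0 × Copies r N) ℂ) : ℂ :=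
  (M * ((1 : Op 0) ⊗ₖ copyState Ψ N)).trace

/-- The expectation value `⟨Ψ|M|Ψ⟩`. -/
def expectation {r : ℕ} (Ψ : Ket r) (M : Op r) : ℂ := (M * Matrix.vecMulVec Ψ (star Ψ)).trace

theorem expectation_eq {r : ℕ} (Ψ : Ket r) (M : Op r) :
    expectation Ψ M = ∑ a, star (Ψ a) * (M *ᵥ Ψ) a := by
  simp only [expectation, Matrix.trace, Matrix.diag_apply, Matrix.mul_apply,
    Matrix.vecMulVec_apply, Matrix.mulVec, dotProduct, Finset.mul_sum, Pi.star_apply]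
  exact Finset.sum_congr rfl fun a _ => Finset.sum_congr rfl fun b _ => by ring

theorem norm_expectation_le_one {r : ℕ} {Ψ : Ket r} (hΨ : ∑ a, ‖Ψ a‖ ^ 2 = 1) {M : Op r}
    (hM : M ∈ pauliStrings r) : ‖expectation Ψ M‖ ≤ 1 := by
  have hMM : Mᴴ * M = 1 := by
    rw [(pauliStrings_family r).herm M hM, (pauliStrings_family r).sq M hM]
  have hnorm : ∀ v : Ket r, ((∑ a, ‖v a‖ ^ 2 : ℝ) : ℂ) = star v ⬝ᵥ v := by
    intro v
    simp only [dotProduct, Pi.star_apply, Complex.ofReal_sum]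
    refine Finset.sum_congr rfl fun a _ => ?_
    rw [Complex.star_def, Complex.conj_mul', Complex.ofReal_pow]
  have hMΨ : ∑ a, ‖(M *ᵥ Ψ) a‖ ^ 2 = 1 := by
    rw [← hΨ, ← Complex.ofReal_inj, hnorm, hnorm, Matrix.star_mulVec, Matrix.dotProduct_mulVec,
      Matrix.vecMul_vecMul, hMM, Matrix.vecMul_one]
  rw [expectation_eq]
  calc ‖∑ a, star (Ψ a) * (M *ᵥ Ψ) a‖ ≤ ∑ a, ‖Ψ a‖ * ‖(M *ᵥ Ψ) a‖ := by
        refine (norm_sum_le _ _).trans (Finset.sum_le_sum fun a _ => ?_)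
        rw [norm_mul, norm_star]
    -- Both vectors are normalized, so the arithmetic-geometric mean inequality replaces
    -- Cauchy–Schwarz.
    _ ≤ ∑ a, (‖Ψ a‖ ^ 2 + ‖(M *ᵥ Ψ) a‖ ^ 2) / 2 := by
        refine Finset.sum_le_sum fun a _ => ?_
        linarith [two_mul_le_add_sq ‖Ψ a‖ ‖(M *ᵥ Ψ) a‖]
    _ = 1 := by rw [← Finset.sum_div, Finset.sum_add_distrib, hΨ, hMΨ]; norm_num

/-- The register is empty, hence one-dimensional, and Pauli strings factorize over the copies. -/
theorem copyValue_joint {r N : ℕ}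
    {M : Matrix (Qubits 0 × Copies r N) (Qubits 0 × Copies r N) ℂ} (hM : M ∈ jointPaulis 0 r N) :
    ∃ A : Fin N → Op r, (∀ j, A j ∈ pauliStrings r) ∧
      ∀ Ψ : Ket r, copyValue Ψ N M = ∏ j, expectation Ψ (A j) := by
  obtain ⟨_, ⟨s, rfl⟩, _, ⟨A, hA, rfl⟩, rfl⟩ := hM
  refine ⟨A, hA, fun Ψ => ?_⟩
  have hs : (pauliString s).trace = 1 := by
    rw [Subsingleton.elim s fun _ => 0, pauliString_zero, Matrix.trace_one]
    simp
  rw [copyValue, copyState, ← Matrix.mul_kronecker_mul, Matrix.trace_kronecker, Matrix.mul_one, hs,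
    one_mul, piMat_mul, trace_piMat]
  rfl

theorem copyValue_neg {r N : ℕ} (Ψ : Ket r)
    (M : Matrix (Qubits 0 × Copies r N) (Qubits 0 × Copies r N) ℂ) :
    copyValue Ψ N (-M) = -copyValue Ψ N M := by
  rw [copyValue, Matrix.neg_mul, Matrix.trace_neg, copyValue]

theorem copyValue_sum {r N : ℕ} (Ψ : Ket r) {ι : Type} (s : Finset ι)
    (M : ι → Matrix (Qubits 0 × Copies r N) (Qubits 0 × Copies r N) ℂ) :
    copyValue Ψ N (∑ i ∈ s, M i) = ∑ i ∈ s, copyValue Ψ N (M i) := by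
  simp only [copyValue, Finset.sum_mul, Matrix.trace_sum]

theorem copyValue_smul {r N : ℕ} (Ψ : Ket r) (c : ℂ)
    (M : Matrix (Qubits 0 × Copies r N) (Qubits 0 × Copies r N) ℂ) :
    copyValue Ψ N (c • M) = c * copyValue Ψ N M := by
  rw [copyValue, Matrix.smul_mul, Matrix.trace_smul, smul_eq_mul, copyValue]

theorem norm_copyValue_le_one {r N : ℕ} {Ψ : Ket r} (hΨ : ∑ a, ‖Ψ a‖ ^ 2 = 1)
    {M : Matrix (Qubits 0 × Copies r N) (Qubits 0 × Copies r N) ℂ}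
    (hM : M ∈ signed (jointPaulis 0 r N)) : ‖copyValue Ψ N M‖ ≤ 1 := by
  have key : ∀ M ∈ jointPaulis 0 r N, ‖copyValue Ψ N M‖ ≤ 1 := by
    intro M hM
    obtain ⟨A, hA, h⟩ := copyValue_joint hM
    rw [h, norm_prod]
    exact Finset.prod_le_one (fun _ _ => norm_nonneg _)
      fun j _ => norm_expectation_le_one hΨ (hA j)
  rcases hM with hM | hM
  · exact key M hM
  · have := key _ hM
    rwa [copyValue_neg, norm_neg] at this

theorem norm_copyValue_sum_le {r N : ℕ} {Ψ : Ket r} (hΨ : ∑ a, ‖Ψ a‖ ^ 2 = 1) {Γ : Type}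
    [CommGroup Γ] [Fintype Γ]
    (φ : Γ →* Matrix (Qubits 0 × Copies r N) (Qubits 0 × Copies r N) ℂ)
    (hφ : ∀ γ, φ γ ∈ signed (jointPaulis 0 r N)) :
    ‖copyValue Ψ N (∑ γ, φ γ)‖ ≤ Fintype.card Γ := by
  rw [copyValue_sum]
  refine (norm_sum_le _ _).trans ((Finset.sum_le_sum fun γ _ =>
    norm_copyValue_le_one hΨ (hφ γ)).trans ?_)
  simp

/-- The embedding of `ℤ[√2]` into `ℂ` that sends `√2` to `√2`. -/
def sqrtTwoHom : ℤ√2 →+* ℂ := Zsqrtd.lift ⟨(Real.sqrt 2 : ℂ), by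
  rw [← Complex.ofReal_mul, Real.mul_self_sqrt (by norm_num)]; norm_num⟩

theorem sqrtTwoHom_injective : Function.Injective sqrtTwoHom := by
  refine Zsqrtd.lift_injective _ fun n h => ?_
  have h1 : n.natAbs * n.natAbs = 2 := by
    rw [← Int.natAbs_mul, ← h]; rfl
  have h2 : n.natAbs < 2 := by nlinarith
  interval_cases n.natAbs <;> omega

/-- The product is the absolute value of the algebraic norm, a nonzero integer. -/
theorem norm_mul_conj_ge_one {x : ℤ√2} (hx : x ≠ 0) :
    1 ≤ ‖sqrtTwoHom x‖ * ‖sqrtTwoHom (star x)‖ := by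
  have h1 : sqrtTwoHom x * sqrtTwoHom (star x) = ((x.norm : ℤ) : ℂ) := by
    rw [← map_mul, ← Zsqrtd.norm_eq_mul_conj, map_intCast]
  have h2 : x.norm ≠ 0 := by
    intro h0
    rw [h0, Int.cast_zero, mul_eq_zero] at h1
    rcases h1 with h1 | h1
    · exact hx (sqrtTwoHom_injective (h1.trans (map_zero _).symm))
    · exact hx (star_eq_zero.mp (sqrtTwoHom_injective (h1.trans (map_zero _).symm)))
  rw [← norm_mul, h1, Complex.norm_intCast]
  exact_mod_cast Int.one_le_abs h2

/-- Up to the normalizations `δ` and `δ'`, the Pauli expectation values of `Ψ` and `Ψ'` are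
conjugate elements of `ℤ[√2]`. -/
def ConjugateKets {r : ℕ} (Ψ Ψ' : Ket r) (δ δ' : ℂ) : Prop :=
  ∀ M ∈ pauliStrings r, ∃ x : ℤ√2, expectation Ψ M * δ = sqrtTwoHom x ∧
    expectation Ψ' M * δ' = sqrtTwoHom (star x)

theorem ConjugateKets.copyValue {r N : ℕ} {Ψ Ψ' : Ket r} {δ δ' : ℂ}
    (h : ConjugateKets Ψ Ψ' δ δ') {M : Matrix (Qubits 0 × Copies r N) (Qubits 0 × Copies r N) ℂ}
    (hM : M ∈ signed (jointPaulis 0 r N)) :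
    ∃ x : ℤ√2, copyValue Ψ N M * δ ^ N = sqrtTwoHom x ∧
      copyValue Ψ' N M * δ' ^ N = sqrtTwoHom (star x) := by
  have key : ∀ M ∈ jointPaulis 0 r N, ∃ x : ℤ√2, _root_.copyValue Ψ N M * δ ^ N = sqrtTwoHom x ∧
      _root_.copyValue Ψ' N M * δ' ^ N = sqrtTwoHom (star x) := by
    intro M hM
    obtain ⟨A, hA, hv⟩ := copyValue_joint hM
    choose x hx hx' using fun j => h (A j) (hA j)
    refine ⟨∏ j, x j, ?_, ?_⟩
    · rw [hv, map_prod, ← Finset.prod_congr rfl fun j _ => hx j, Finset.prod_mul_distrib]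
      simp
    · rw [hv, star_prod, map_prod, ← Finset.prod_congr rfl fun j _ => hx' j,
        Finset.prod_mul_distrib]
      simp
  rcases hM with hM | hM
  · exact key M hM
  · obtain ⟨x, hx, hx'⟩ := key _ hM
    refine ⟨-x, ?_, ?_⟩
    · rw [map_neg, ← hx, copyValue_neg]; ring
    · rw [star_neg, map_neg, ← hx', copyValue_neg]; ring

/-- By `IsPauliFamily.sum_group`, the two values, scaled by `(2 ^ r * δ) ^ N` and `(2 ^ r * δ') ^
N`, are the integer `card Γ * R` times conjugate elements of `ℤ[√2]`. Their product is bounded below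
by `norm_mul_conj_ge_one`. The explicit factor `card Γ` makes the bound independent of the size of
the group. -/
theorem ConjugateKets.norm_mul_norm_ge {r N : ℕ} {Ψ Ψ' : Ket r} {δ δ' : ℂ}
    (h : ConjugateKets Ψ Ψ' δ δ') {Γ : Type} [CommGroup Γ] [Fintype Γ]
    (φ : Γ →* Matrix (Qubits 0 × Copies r N) (Qubits 0 × Copies r N) ℂ)
    (hφ : ∀ γ, φ γ ∈ signed (jointPaulis 0 r N))
    (h0 : _root_.copyValue Ψ N (∑ γ, φ γ) ≠ 0) (hδ : δ ≠ 0) :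
    (Fintype.card Γ : ℝ) ^ 2 ≤ ‖_root_.copyValue Ψ N (∑ γ, φ γ)‖ *
      ‖_root_.copyValue Ψ' N (∑ γ, φ γ)‖ * (4 ^ r * ‖δ * δ'‖) ^ N := by
  obtain ⟨R, G, hG, hS⟩ := (jointPaulis_family 0 r N).sum_group φ hφ
  have hcard : Fintype.card (Qubits 0 × Copies r N) = (2 ^ r) ^ N := by simp
  rw [hcard] at hS
  obtain ⟨x, hx, hx'⟩ : ∃ x : ℤ√2, _root_.copyValue Ψ N (∑ g ∈ G, g) * δ ^ N = sqrtTwoHom x ∧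
      _root_.copyValue Ψ' N (∑ g ∈ G, g) * δ' ^ N = sqrtTwoHom (star x) := by
    choose! x hx hx' using fun g hg => h.copyValue (hG g hg)
    refine ⟨∑ g ∈ G, x g, ?_, ?_⟩
    · rw [copyValue_sum, Finset.sum_mul, map_sum]
      exact Finset.sum_congr rfl hx
    · rw [copyValue_sum, Finset.sum_mul, star_sum, map_sum]
      exact Finset.sum_congr rfl hx'
  have key : ∀ Φ : Ket r, ∀ (d : ℂ) (y : ℤ√2),
      _root_.copyValue Φ N (∑ g ∈ G, g) * d ^ N = sqrtTwoHom y →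
      ‖_root_.copyValue Φ N (∑ γ, φ γ)‖ * (2 ^ r * ‖d‖) ^ N =
        Fintype.card Γ * R * ‖sqrtTwoHom y‖ := by
    intro Φ d y hy
    have := congrArg (fun M => ‖_root_.copyValue Φ N M * d ^ N‖) hS
    simp only [copyValue_smul, mul_assoc, hy] at this
    simp only [norm_mul, norm_pow, Complex.norm_natCast] at this
    push_cast at this
    rw [← this, mul_pow]
    ring
  have h1 := key Ψ δ x hx
  have h2 := key Ψ' δ' (star x) hx'
  have hR : R ≠ 0 := by
    rintro rfl
    rw [Nat.cast_zero, mul_zero, zero_mul, mul_eq_zero] at h1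
    rcases h1 with h1 | h1
    · exact h0 (norm_eq_zero.mp h1)
    · have : 0 < (2 ^ r * ‖δ‖) ^ N := by positivity
      exact this.ne' h1
  have hx0 : x ≠ 0 := by
    rintro rfl
    rw [map_zero, norm_zero, mul_zero, mul_eq_zero] at h1
    rcases h1 with h1 | h1
    · exact h0 (norm_eq_zero.mp h1)
    · have : 0 < (2 ^ r * ‖δ‖) ^ N := by positivity
      exact this.ne' h1
  have hR1 : (1 : ℝ) ≤ R := by exact_mod_cast Nat.one_le_iff_ne_zero.mpr hR
  have h3 := norm_mul_conj_ge_one hx0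
  calc (Fintype.card Γ : ℝ) ^ 2 ≤ (Fintype.card Γ : ℝ) ^ 2 *
        ((R : ℝ) ^ 2 * (‖sqrtTwoHom x‖ * ‖sqrtTwoHom (star x)‖)) :=
        le_mul_of_one_le_right (by positivity)
          (one_le_mul_of_one_le_of_one_le (one_le_pow₀ hR1) h3)
    _ = (Fintype.card Γ * R * ‖sqrtTwoHom x‖) * (Fintype.card Γ * R * ‖sqrtTwoHom (star x)‖) := by
        ring
    _ = _ := by
        rw [← h1, ← h2, norm_mul, show (4 : ℝ) = 2 * 2 by norm_num]
        simp only [mul_pow]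
        ring

/-- The value of a stabilizer projection on `N` copies of `Ψ` is zero or at least `2 ^ (-c N)`. -/
def StabilizerGap {r : ℕ} (Ψ : Ket r) (c : ℕ) : Prop :=
  ∀ (N : ℕ) (Γ : Type) (_ : CommGroup Γ) (_ : Fintype Γ)
    (φ : Γ →* Matrix (Qubits 0 × Copies r N) (Qubits 0 × Copies r N) ℂ),
    (∀ γ, φ γ ∈ signed (jointPaulis 0 r N)) → copyValue Ψ N (∑ γ, φ γ) = 0 ∨
      (Fintype.card Γ : ℝ) ≤ 2 ^ (c * N) * ‖copyValue Ψ N (∑ γ, φ γ)‖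

/-- For a post-selected stabilizer circuit with stabilizer input, the probability of an outcome of
a final Pauli measurement is zero, one half, or at least `2 ^ (-c N)`. -/
theorem IsStabEffect.outcome {r : ℕ} {Ψ : Ket r} (hΨ : ∑ a, ‖Ψ a‖ ^ 2 = 1) {c N : ℕ}
    (hgap : StabilizerGap Ψ c) {f g : Op 0 → ℂ} (H : IsStabEffect Ψ N f g) (σ : ℤˣ) :
    f 1 + σ * g 1 = 0 ∨ f 1 + σ * g 1 = f 1 ∨ ‖f 1‖ ≤ 2 ^ (c * N) * ‖(f 1 + σ * g 1) / 2‖ := by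
  obtain ⟨E, h, ⟨Γ, _, _, φ, a, ha, hφ, rfl, hh⟩, hf, hg⟩ := H
  have hB := jointPaulis_family 0 r N
  rcases hh with rfl | ⟨q, hq, hqφ, rfl⟩
  · right; left
    rw [hg]
    simp
  set q' : Matrix (Qubits 0 × Copies r N) (Qubits 0 × Copies r N) ℂ := (σ : ℂ) • q with hq'
  have hq'B : q' ∈ signed (jointPaulis 0 r N) := by
    rcases Int.units_eq_one_or σ with rfl | rfl
    · simpa [hq'] using hq
    · rw [hq']
      simpa [signed, or_comm] using hq
  have hc : ∀ γ, φ γ * q' = q' * φ γ := by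
    intro γ
    rw [hq', Matrix.mul_smul, Matrix.smul_mul, hqφ]
  have hsum : f 1 + σ * g 1 =
      a * copyValue Ψ N (∑ x, extendHom φ q' (hB.signed_sq hq'B) hc x) := by
    rw [hf, hg, sum_extendHom]
    simp only [copyValue, hq', Matrix.mul_add, Matrix.mul_one, Matrix.mul_smul, Matrix.smul_mul,
      Matrix.add_mul, Matrix.trace_add, Matrix.trace_smul, smul_eq_mul]
    ring
  have hf1 : f 1 = a * copyValue Ψ N (∑ γ, φ γ) := by
    rw [hf, ← copyValue_smul]
    rfl
  rcases hgap N _ inferInstance inferInstance (extendHom φ q' (hB.signed_sq hq'B) hc)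
    (extendHom_mem hB φ hφ hq'B _ hc) with h0 | h0
  · left
    rw [hsum, h0, mul_zero]
  · right; right
    have h1 := norm_copyValue_sum_le hΨ φ hφ
    have h2 : Fintype.card (Γ × ℤˣ) = Fintype.card Γ * 2 := by
      rw [Fintype.card_prod]; rfl
    rw [h2] at h0
    push_cast at h0
    rw [hsum, hf1, norm_mul, norm_div, norm_mul, Complex.norm_real, Real.norm_of_nonneg ha,
      Complex.norm_two]
    nlinarith [mul_le_mul_of_nonneg_left (h1.trans (by linarith : (Fintype.card Γ : ℝ) ≤
      2 ^ (c * N) * ‖copyValue Ψ N (∑ x, extendHom φ q' (hB.signed_sq hq'B) hc x)‖ / 2)) ha]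

/-! ### The resource states -/

/-- The entries of the Pauli matrices as Gaussian integers. -/
def gaussianPauli : Fin 4 → Matrix (Fin 2) (Fin 2) GaussianInt :=
  ![!![1, 0; 0, 1], !![0, 1; 1, 0], !![0, ⟨0, -1⟩; ⟨0, 1⟩, 0], !![1, 0; 0, -1]]

theorem gaussianPauli_toComplex (s : Fin 4) (x y : Fin 2) :
    GaussianInt.toComplex (gaussianPauli s x y) = pauliMatrix s x y := by
  fin_cases s <;> fin_cases x <;> fin_cases y <;>
    simp [gaussianPauli, pauliMatrix, GaussianInt.toComplex_def]

/-- The matrix element of a Pauli string in the unnormalized state `∑ v a |a⟩`. -/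
def gaussianExpectation {r : ℕ} (ω : GaussianInt) (s : Fin r → Fin 4) : GaussianInt :=
  ∑ a : Fin r → Fin 2, ∑ b : Fin r → Fin 2, (∏ i, gaussianPauli (s i) (a i) (b i)) *
    ((if ∀ i, b i = 1 then ω else 1) * star (if ∀ i, a i = 1 then ω else 1))

/-- A check of all 16 strings. The divisibility puts the expectation values in `½ℤ` instead of `¼ℤ`,
and this denominator fixes the gap exponent. -/
theorem gaussianExpectation_CS (s : Fin 2 → Fin 4) :
    (gaussianExpectation (r := 2) ⟨0, 1⟩ s).im = 0 ∧
      (2 : ℤ) ∣ (gaussianExpectation (r := 2) ⟨0, 1⟩ s).re := by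
  revert s
  decide +kernel

/-- A check of all 64 strings; again the expectation values lie in `½ℤ`, although the normalization
is `1/8`. -/
theorem gaussianExpectation_CCZ (s : Fin 3 → Fin 4) :
    (gaussianExpectation (r := 3) (-1) s).im = 0 ∧
      (4 : ℤ) ∣ (gaussianExpectation (r := 3) (-1) s).re := by
  revert s
  decide +kernel

/-- The resource state of the gate that multiplies `|1…1⟩` by `ω`. -/
def phaseKet (r : ℕ) (ω : ℂ) : Ket r := controlledPhase r ω *ᵥ ketPlus r

theorem phaseKet_apply (r : ℕ) (ω : ℂ) (a : Qubits r) :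
    phaseKet r ω a = (if ∀ i, a i = 1 then ω else 1) * (1 / (Real.sqrt (2 ^ r) : ℂ)) := by
  rw [phaseKet, controlledPhase, Matrix.mulVec_diagonal, ketPlus]

theorem sum_norm_phaseKet (r : ℕ) {ω : ℂ} (hω : ‖ω‖ = 1) : ∑ a, ‖phaseKet r ω a‖ ^ 2 = 1 := by
  have h : ∀ a, ‖phaseKet r ω a‖ ^ 2 = 1 / 2 ^ r := by
    intro a
    have : ‖(if ∀ i, a i = 1 then ω else 1)‖ = 1 := by split_ifs <;> simp [hω]
    rw [phaseKet_apply, norm_mul, this, one_mul, norm_div, norm_one, Complex.norm_real,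
      Real.norm_of_nonneg (Real.sqrt_nonneg _), div_pow, Real.sq_sqrt (by positivity), one_pow]
  simp [h]

theorem expectation_phaseKet (r : ℕ) (ω : ℂ) (s : Fin r → Fin 4) :
    expectation (phaseKet r ω) (pauliString s) = 1 / 2 ^ r * ∑ a, ∑ b, pauliString s a b *
      ((if ∀ i, b i = 1 then ω else 1) * star (if ∀ i, a i = 1 then ω else 1)) := by
  have h2 : (1 / (Real.sqrt (2 ^ r) : ℂ)) * (1 / (Real.sqrt (2 ^ r) : ℂ)) = 1 / 2 ^ r := by
    rw [div_mul_div_comm, ← Complex.ofReal_mul, Real.mul_self_sqrt (by positivity)]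
    push_cast
    ring
  have h3 : star (1 / (Real.sqrt (2 ^ r) : ℂ)) = 1 / (Real.sqrt (2 ^ r) : ℂ) := by
    rw [star_div₀, star_one, Complex.star_def, Complex.conj_ofReal]
  simp only [expectation, Matrix.trace, Matrix.diag_apply, Matrix.mul_apply,
    Matrix.vecMulVec_apply, Pi.star_apply, Finset.mul_sum]
  refine Finset.sum_congr rfl fun a _ => Finset.sum_congr rfl fun b _ => ?_
  rw [phaseKet_apply, phaseKet_apply, star_mul', h3, ← h2]
  ring

theorem expectation_phaseKet_gaussian (r : ℕ) (ω : GaussianInt) (s : Fin r → Fin 4) :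
    expectation (phaseKet r (GaussianInt.toComplex ω)) (pauliString s) =
      1 / 2 ^ r * GaussianInt.toComplex (gaussianExpectation ω s) := by
  rw [expectation_phaseKet, gaussianExpectation]
  simp only [map_sum, map_mul, map_prod, gaussianPauli_toComplex, apply_ite, map_one,
    GaussianInt.toComplex_star, star_one, pauliString, Matrix.of_apply, Complex.star_def]

theorem conjugateKets_gaussian (r : ℕ) (ω : GaussianInt)
    (h : ∀ s : Fin (r + 1) → Fin 4, (gaussianExpectation ω s).im = 0 ∧
      (2 ^ r : ℤ) ∣ (gaussianExpectation ω s).re) :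
    ConjugateKets (phaseKet (r + 1) (GaussianInt.toComplex ω))
      (phaseKet (r + 1) (GaussianInt.toComplex ω)) 2 2 := by
  rintro _ ⟨s, rfl⟩
  obtain ⟨h1, k, h2⟩ := h s
  have h3 : expectation (phaseKet (r + 1) (GaussianInt.toComplex ω)) (pauliString s) * 2 = k := by
    rw [expectation_phaseKet_gaussian, GaussianInt.toComplex_def, h1, h2]
    push_cast
    field_simp
    ring
  refine ⟨k, ?_, ?_⟩
  · rw [h3, map_intCast]
  · rw [h3, star_intCast, map_intCast]

/-- Half-integral expectation values make the state its own conjugate, so the product bound becomes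
a bound on the square of one value, and the exponent of `4 ^ r * 4` is halved. -/
theorem stabilizerGap_of_self {r : ℕ} {Ψ : Ket r} (h : ConjugateKets Ψ Ψ 2 2) :
    StabilizerGap Ψ (r + 1) := by
  intro N Γ _ _ φ hφ
  by_cases h0 : copyValue Ψ N (∑ γ, φ γ) = 0
  · exact Or.inl h0
  · right
    have h1 := h.norm_mul_norm_ge φ hφ h0 two_ne_zero
    have h2 : (4 ^ r * ‖(2 : ℂ) * 2‖) ^ N = ((2 : ℝ) ^ ((r + 1) * N)) ^ 2 := by
      rw [norm_mul, Complex.norm_two, ← pow_mul, show (4 : ℝ) = 2 ^ 2 by norm_num, ← pow_mul,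
        ← sq, ← pow_add, ← pow_mul]
      congr 1
      ring
    rw [h2] at h1
    refine le_of_sq_le_sq ?_ (by positivity)
    linarith

theorem ketCS_eq : ketCS = phaseKet 2 (GaussianInt.toComplex ⟨0, 1⟩) := by
  rw [ketCS, phaseKet]
  congr 2
  simp [GaussianInt.toComplex_def]

theorem ketCCZ_eq : ketCCZ = phaseKet 3 (GaussianInt.toComplex (-1)) := by
  rw [ketCCZ, phaseKet]
  congr 2
  simp

theorem stabilizerGap_CS : StabilizerGap ketCS 3 := by
  rw [ketCS_eq]
  refine stabilizerGap_of_self (conjugateKets_gaussian 1 _ ?_)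
  simpa using gaussianExpectation_CS

theorem stabilizerGap_CCZ : StabilizerGap ketCCZ 4 := by
  rw [ketCCZ_eq]
  refine stabilizerGap_of_self (conjugateKets_gaussian 2 _ ?_)
  simpa using gaussianExpectation_CCZ

/-- Either sign of the root `c` is allowed: one gives `ketT`, the other its image under `√2 ↦ -√2`.
-/
theorem expectation_phaseKet_one (c : ℝ) (hc : c * c = 1 / 2) (s : Fin 1 → Fin 4) :
    expectation (phaseKet 1 (c * (1 + Complex.I))) (pauliString s) = ![1, (c : ℂ), c, 0] (s 0) := by
  have hω : (c : ℂ) * (1 + Complex.I) * (c * (1 + -Complex.I)) = 1 := by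
    have : (c : ℂ) * c = 1 / 2 := by rw [← Complex.ofReal_mul, hc]; norm_num
    linear_combination 2 * this - (c * c : ℂ) * Complex.I_sq
  have hs : ∀ F : Qubits 1 → ℂ, ∑ a, F a = F (fun _ => 0) + F (fun _ => 1) := by
    intro F
    rw [← (Equiv.funUnique (Fin 1) (Fin 2)).symm.sum_comp, Fin.sum_univ_two]
    rfl
  rw [expectation_phaseKet]
  simp only [hs, pauliString, Matrix.of_apply, Fin.prod_univ_one]
  generalize s 0 = x
  fin_cases x
  · simp [pauliMatrix, hω]
    norm_num
  · simp [pauliMatrix]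
    ring_nf
  · simp [pauliMatrix]
    ring_nf
    simp
  · simp [pauliMatrix, hω]

theorem exp_pi_div_four :
    Complex.exp (Complex.I * Real.pi / 4) = ((Real.sqrt 2 / 2 : ℝ) : ℂ) * (1 + Complex.I) := by
  rw [show Complex.I * (Real.pi : ℂ) / 4 = ((Real.pi / 4 : ℝ) : ℂ) * Complex.I by push_cast; ring,
    Complex.exp_mul_I, ← Complex.ofReal_cos, ← Complex.ofReal_sin, Real.cos_pi_div_four,
    Real.sin_pi_div_four]
  ring

theorem norm_phase {c : ℝ} (hc : c * c = 1 / 2) : ‖(c : ℂ) * (1 + Complex.I)‖ = 1 := by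
  have : ‖(c : ℂ) * (1 + Complex.I)‖ ^ 2 = 1 := by
    rw [Complex.sq_norm, Complex.normSq_apply]
    simp
    linarith
  exact (pow_eq_one_iff_of_nonneg (norm_nonneg _) two_ne_zero).mp this

theorem ketT_eq : ketT = phaseKet 1 (((Real.sqrt 2 / 2 : ℝ) : ℂ) * (1 + Complex.I)) := by
  rw [ketT, exp_pi_div_four, phaseKet]

theorem sqrt_two_div_two_mul_self : Real.sqrt 2 / 2 * (Real.sqrt 2 / 2) = 1 / 2 := by
  nlinarith [Real.mul_self_sqrt (zero_le_two (α := ℝ))]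

theorem conjugateKets_T : ConjugateKets ketT
    (phaseKet 1 (((-(Real.sqrt 2 / 2) : ℝ) : ℂ) * (1 + Complex.I))) (Real.sqrt 2 : ℂ)
    (-(Real.sqrt 2 : ℂ)) := by
  have h2 : (Real.sqrt 2 : ℂ) * (Real.sqrt 2 : ℂ) = 2 := by
    rw [← Complex.ofReal_mul, Real.mul_self_sqrt (by norm_num)]; norm_num
  rintro _ ⟨s, rfl⟩
  rw [ketT_eq, expectation_phaseKet_one _ sqrt_two_div_two_mul_self,
    expectation_phaseKet_one _ (by rw [neg_mul_neg, sqrt_two_div_two_mul_self])]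
  generalize s 0 = x
  refine ⟨![⟨0, 1⟩, 1, 1, 0] x, ?_⟩
  fin_cases x
  · simp [sqrtTwoHom, Zsqrtd.lift]
  · simp
    linear_combination h2 / 2
  · simp
    linear_combination h2 / 2
  · simp

theorem sum_norm_ketT : ∑ a, ‖ketT a‖ ^ 2 = 1 := by
  rw [ketT_eq]
  exact sum_norm_phaseKet 1 (norm_phase sqrt_two_div_two_mul_self)

theorem sum_norm_ketCS : ∑ a, ‖ketCS a‖ ^ 2 = 1 := by
  rw [ketCS_eq]
  exact sum_norm_phaseKet 2 (by simp [GaussianInt.toComplex_def])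

theorem sum_norm_ketCCZ : ∑ a, ‖ketCCZ a‖ ^ 2 = 1 := by
  rw [ketCCZ_eq]
  exact sum_norm_phaseKet 3 (by simp)

/-- The conjugate of `ketT` is again a normalized state, so its value is at most `card Γ`. The
product bound then leaves `8 ^ N = (4 * √2 * √2) ^ N`. -/
theorem stabilizerGap_T : StabilizerGap ketT 3 := by
  intro N Γ _ _ φ hφ
  by_cases h0 : copyValue ketT N (∑ γ, φ γ) = 0
  · exact Or.inl h0
  · right
    have hs : (Real.sqrt 2 : ℂ) ≠ 0 := by simp
    have h1 := conjugateKets_T.norm_mul_norm_ge φ hφ h0 hs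
    have h2 : (4 ^ 1 * ‖(Real.sqrt 2 : ℂ) * -(Real.sqrt 2 : ℂ)‖) ^ N = (2 : ℝ) ^ (3 * N) := by
      rw [mul_neg, norm_neg, ← Complex.ofReal_mul, Real.mul_self_sqrt (by norm_num), pow_mul]
      norm_num
    have h3 := norm_copyValue_sum_le (sum_norm_phaseKet 1 (norm_phase (c := -(Real.sqrt 2 / 2))
      (by rw [neg_mul_neg, sqrt_two_div_two_mul_self]))) φ hφ
    rw [h2] at h1
    have hΓ : (0 : ℝ) < Fintype.card Γ := by exact_mod_cast Fintype.card_pos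
    refine le_of_mul_le_mul_right ?_ hΓ
    calc (Fintype.card Γ : ℝ) * Fintype.card Γ = (Fintype.card Γ : ℝ) ^ 2 := by ring
      _ ≤ _ := h1
      _ ≤ ‖copyValue ketT N (∑ γ, φ γ)‖ * Fintype.card Γ * 2 ^ (3 * N) := by gcongr
      _ = _ := by ring

/-! ### Positivity and trace preservation -/

theorem posSemidef_reduceTo {n : ℕ} (i : Fin n) {ρ : Op n} (hρ : ρ.PosSemidef) :
    (reduceTo i ρ).PosSemidef := by
  -- The partial trace is a sum of principal submatrices, one for each assignment of the other
  -- qubits; labels with `c i = 0` represent these assignments.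
  have h : reduceTo i ρ = ∑ c ∈ Finset.univ.filter (fun c : Qubits n => c i = 0),
      ρ.submatrix (fun x => Function.update c i x) (fun x => Function.update c i x) := by
    ext x y
    rw [Matrix.sum_apply]
    simp only [reduceTo, LinearMap.coe_mk, AddHom.coe_mk, Matrix.of_apply, Matrix.submatrix_apply]
    rw [← Finset.sum_filter]
    refine Finset.sum_bij' (fun a _ => Function.update a i 0) (fun c _ => Function.update c i x)
      ?_ ?_ ?_ ?_ ?_
    · intro a _; simp
    · intro c _; simp
    · intro a ha
      simp only [Finset.mem_filter, Finset.mem_univ, true_and] at ha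
      simp [← ha]
    · intro c hc
      simp only [Finset.mem_filter, Finset.mem_univ, true_and] at hc
      simp [← hc]
    · intro a ha
      simp only [Finset.mem_filter, Finset.mem_univ, true_and] at ha
      simp [← ha]
  rw [h]
  exact Matrix.posSemidef_sum _ fun c _ => hρ.submatrix _

theorem Protocol.posSemidef_run {r : ℕ} {Ψ : Ket r} {n : ℕ} (π : Protocol Ψ n) :
    ∀ b ∈ π.branches, ∀ ρ : Op n, ρ.PosSemidef → (b.run ρ).PosSemidef := by
  induction π with
  | output i =>
    intro b hb ρ hρ
    rw [Protocol.branches, List.mem_singleton] at hb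
    subst hb
    exact posSemidef_reduceTo i hρ
  | clifford V hV next ih =>
    intro b hb ρ hρ
    obtain ⟨b', hb', rfl⟩ := List.mem_map.mp hb
    exact ih b' hb' _ (hρ.mul_mul_conjTranspose_same _)
  | ancilla next ih =>
    intro b hb ρ hρ
    obtain ⟨b', hb', rfl⟩ := List.mem_map.mp hb
    exact ih b' hb' _ (hρ.mul_mul_conjTranspose_same _)
  | measure t next ih =>
    intro b hb ρ hρ
    rcases List.mem_append.mp hb with hb | hb <;> obtain ⟨b', hb', rfl⟩ := List.mem_map.mp hb
    · exact ih false b' hb' _ (hρ.mul_mul_conjTranspose_same _)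
    · exact ih true b' hb' _ (hρ.mul_mul_conjTranspose_same _)
  | random p hp next ih =>
    intro b hb ρ hρ
    rcases List.mem_append.mp hb with hb | hb <;> obtain ⟨b', hb', rfl⟩ := List.mem_map.mp hb
    · exact (ih false b' hb' ρ hρ).smul (by exact_mod_cast sub_nonneg.mpr hp.2)
    · exact (ih true b' hb' ρ hρ).smul (by exact_mod_cast hp.1)
  | resource next ih =>
    intro b hb ρ hρ
    obtain ⟨b', hb', rfl⟩ := List.mem_map.mp hb
    exact ih b' hb' _ (hρ.mul_mul_conjTranspose_same _)

theorem trace_conjBy {m n : Type} [Fintype m] [Fintype n] [DecidableEq n] {K : Matrix m n ℂ}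
    (hK : Kᴴ * K = 1) (ρ : Matrix n n ℂ) : (conjBy K ρ).trace = ρ.trace := by
  change (K * ρ * Kᴴ).trace = _
  rw [Matrix.trace_mul_comm, ← Matrix.mul_assoc, hK, Matrix.one_mul]

theorem trace_conjBy_pauliProjector {n : ℕ} (s : Fin n → Fin 4) (ρ : Op n) :
    (conjBy (pauliProjector s false) ρ).trace + (conjBy (pauliProjector s true) ρ).trace =
      ρ.trace := by
  have hP := (pauliStrings_family n).herm _ ⟨s, rfl⟩
  have hP2 := (pauliStrings_family n).sq _ ⟨s, rfl⟩
  have key : ∀ o, (pauliProjector s o)ᴴ * pauliProjector s o = pauliProjector s o := by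
    intro o
    have hh : (pauliProjector s o)ᴴ = pauliProjector s o := by
      rw [pauliProjector, Matrix.conjTranspose_smul, Matrix.conjTranspose_add,
        Matrix.conjTranspose_smul, hP]
      cases o <;> simp
    rw [hh, pauliProjector]
    simp only [Matrix.smul_mul, Matrix.mul_smul, Matrix.add_mul, Matrix.mul_add, hP2,
      Matrix.one_mul, Matrix.mul_one]
    cases o <;> simp only [if_true, Bool.false_eq_true, if_false] <;> module
  have hsum : pauliProjector s false + pauliProjector s true = 1 := by
    simp only [pauliProjector, if_true, Bool.false_eq_true, if_false]
    module
  change (pauliProjector s false * ρ * (pauliProjector s false)ᴴ).trace +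
    (pauliProjector s true * ρ * (pauliProjector s true)ᴴ).trace = _
  rw [Matrix.trace_mul_comm, ← Matrix.mul_assoc, key, Matrix.trace_mul_comm (_ * ρ),
    ← Matrix.mul_assoc, key, ← Matrix.trace_add, ← Matrix.add_mul, hsum, Matrix.one_mul]

theorem Protocol.sum_trace_run {r : ℕ} {Ψ : Ket r} (hΨ : ∑ a, ‖Ψ a‖ ^ 2 = 1) {n : ℕ}
    (π : Protocol Ψ n) :
    ∀ ρ : Op n, (π.branches.map fun b => (b.run ρ).trace).sum = ρ.trace := by
  have hΨ' : ∑ c, star (Ψ c) * Ψ c = 1 := by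
    have := congrArg Complex.ofReal hΨ
    rw [Complex.ofReal_sum, Complex.ofReal_one] at this
    rw [← this]
    refine Finset.sum_congr rfl fun a _ => ?_
    rw [Complex.star_def, Complex.conj_mul', Complex.ofReal_pow]
  induction π with
  | output i =>
    intro ρ
    have := trace_reduceTo i 0 ρ
    rw [pauliMatrix_zero, Matrix.one_mul, Function.update_eq_self_iff.mpr rfl,
      pauliString_zero, Matrix.one_mul] at this
    simpa [Protocol.branches] using this
  | clifford V hV next ih =>
    intro ρ
    rw [Protocol.branches, List.map_map]
    exact (ih _).trans (trace_conjBy (Matrix.mem_unitaryGroup_iff'.mp hV.1) ρ)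
  | ancilla next ih =>
    intro ρ
    rw [Protocol.branches, List.map_map]
    exact (ih _).trans (trace_conjBy (appendKet_isometry sum_ketZero) ρ)
  | measure t next ih =>
    intro ρ
    rw [Protocol.branches, List.map_append, List.sum_append, List.map_map, List.map_map,
      ← trace_conjBy_pauliProjector t ρ]
    exact congrArg₂ _ (ih false _) (ih true _)
  | random p hp next ih =>
    intro ρ
    rw [Protocol.branches, List.map_append, List.sum_append, List.map_map, List.map_map]
    simp only [Function.comp_def, LinearMap.smul_apply, Matrix.trace_smul, smul_eq_mul,
      List.sum_map_mul_left, ih]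
    push_cast
    ring
  | resource next ih =>
    intro ρ
    rw [Protocol.branches, List.map_map]
    exact (ih _).trans (trace_conjBy (appendKet_isometry hΨ') ρ)

/-! ### Fidelity of single-qubit states -/

/-- Here `a, b` are the populations of a qubit state, `x, y` those of a pure state, and `w` the
coherence term of their overlap. The worst case is `w = m = √(xyab)`, where the left side factors as
a difference of squares, and `2m ≤ yb + xa` bounds one factor by `a + b`. -/
theorem sq_sub_le_mul_of_sq_le {a b x y w : ℝ} (ha : 0 ≤ a) (hb : 0 ≤ b) (hx : 0 ≤ x)
    (hy : 0 ≤ y) (hxy : x + y = 1) (hw : w ^ 2 ≤ (x * y) * (a * b)) :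
    0 ≤ y * a + x * b - 2 * w ∧
      (y * a - x * b) ^ 2 ≤ (a + b) * (y * a + x * b - 2 * w) := by
  set m := Real.sqrt ((x * y) * (a * b)) with hm
  have hm0 : 0 ≤ m := Real.sqrt_nonneg _
  have hm2 : m ^ 2 = (x * y) * (a * b) := Real.sq_sqrt (by positivity)
  have hwm : w ≤ m := Real.le_sqrt_of_sq_le hw
  have h1 : 2 * m ≤ y * a + x * b := by
    refine abs_le_of_sq_le_sq' ?_ (by positivity) |>.2
    nlinarith [sq_nonneg (y * a - x * b)]
  have h2 : 2 * m ≤ y * b + x * a := by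
    refine abs_le_of_sq_le_sq' ?_ (by positivity) |>.2
    nlinarith [sq_nonneg (y * b - x * a)]
  refine ⟨by linarith, ?_⟩
  have h3 : a + b = (y * a + x * b) + (y * b + x * a) := by
    linear_combination (-(a + b)) * hxy
  calc (y * a - x * b) ^ 2 = (y * a + x * b + 2 * m) * (y * a + x * b - 2 * m) := by
        linear_combination 4 * hm2
    _ ≤ (a + b) * (y * a + x * b - 2 * m) :=
        mul_le_mul_of_nonneg_right (by linarith) (by linarith)
    _ ≤ _ := mul_le_mul_of_nonneg_left (by linarith) (by linarith)

/-- The infidelity of `σ` with the pure state `ψ`, for unnormalized `σ`. -/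
def infidelity (σ : QubitOp) (ψ : Fin 2 → ℂ) : ℝ := (σ.trace - star ψ ⬝ᵥ σ *ᵥ ψ).re

/-- A population of `σ` can deviate from that of `ψ` by at most the square root of the infidelity,
up to normalization. Positivity of the determinant controls the off-diagonal entry. -/
theorem infidelity_bound {σ : QubitOp} (hσ : σ.PosSemidef) {ψ : Fin 2 → ℂ}
    (hψ : ∑ i, ‖ψ i‖ ^ 2 = 1) :
    0 ≤ infidelity σ ψ ∧ ∀ k, ((σ k k).re - ‖ψ k‖ ^ 2 * σ.trace.re) ^ 2 ≤
      σ.trace.re * infidelity σ ψ := by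
  have h00 := Complex.le_def.mp (hσ.diag_nonneg (i := 0))
  have h11 := Complex.le_def.mp (hσ.diag_nonneg (i := 1))
  have h10 : σ 1 0 = star (σ 0 1) := (hσ.1.apply 1 0).symm
  have hdet := (Complex.le_def.mp hσ.det_nonneg).1
  rw [Matrix.det_fin_two, h10] at hdet
  simp only [Complex.star_def, Complex.sub_re, Complex.mul_re, Complex.conj_re, Complex.conj_im,
    Complex.zero_re, Complex.zero_im] at hdet h00 h11
  rw [← h00.2, ← h11.2] at hdet
  rw [Fin.sum_univ_two] at hψ
  have hD : infidelity σ ψ = ‖ψ 1‖ ^ 2 * (σ 0 0).re + ‖ψ 0‖ ^ 2 * (σ 1 1).re -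
      2 * (star (ψ 0) * σ 0 1 * ψ 1).re := by
    have h0 : ‖ψ 0‖ ^ 2 = 1 - ‖ψ 1‖ ^ 2 := by linarith
    simp only [infidelity, Matrix.trace_fin_two, dotProduct, Matrix.mulVec, Fin.sum_univ_two, h10,
      Pi.star_apply]
    rw [Complex.sq_norm, Complex.normSq_apply] at *
    rw [Complex.sq_norm, Complex.normSq_apply] at *
    simp only [Complex.star_def, Complex.sub_re, Complex.add_re, Complex.mul_re, Complex.conj_re,
      Complex.conj_im, Complex.mul_im, Complex.add_im, ← h00.2, ← h11.2]
    linear_combination - ((σ 0 0).re + (σ 1 1).re) * hψ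
  have hw : (star (ψ 0) * σ 0 1 * ψ 1).re ^ 2 ≤
      (‖ψ 0‖ ^ 2 * ‖ψ 1‖ ^ 2) * ((σ 0 0).re * (σ 1 1).re) := by
    have h1 : (star (ψ 0) * σ 0 1 * ψ 1).re ^ 2 ≤ ‖star (ψ 0) * σ 0 1 * ψ 1‖ ^ 2 :=
      sq_le_sq.mpr ((Complex.abs_re_le_norm _).trans (le_abs_self _))
    have h2 : ‖σ 0 1‖ ^ 2 ≤ (σ 0 0).re * (σ 1 1).re := by
      rw [Complex.sq_norm, Complex.normSq_apply]
      linarith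
    refine h1.trans ?_
    rw [norm_mul, norm_mul, norm_star, mul_pow, mul_pow]
    nlinarith [mul_le_mul_of_nonneg_left h2 (by positivity : 0 ≤ ‖ψ 0‖ ^ 2 * ‖ψ 1‖ ^ 2)]
  have key := sq_sub_le_mul_of_sq_le h00.1 h11.1 (sq_nonneg ‖ψ 0‖) (sq_nonneg ‖ψ 1‖) hψ hw
  rw [← hD] at key
  have htr : σ.trace.re = (σ 0 0).re + (σ 1 1).re := by
    rw [Matrix.trace_fin_two, Complex.add_re]
  refine ⟨key.1, fun k => ?_⟩
  rw [htr]
  refine le_of_eq_of_le ?_ key.2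
  fin_cases k
  · change ((σ 0 0).re - ‖ψ 0‖ ^ 2 * _) ^ 2 = _
    congr 1
    linear_combination (-(σ 0 0).re) * hψ
  · change ((σ 1 1).re - ‖ψ 1‖ ^ 2 * _) ^ 2 = _
    rw [← neg_sq]
    congr 1
    linear_combination ((σ 1 1).re) * hψ

/-! ### Consequences of a bound on the diamond norm -/

theorem trace_conjTranspose_mul_self_le_sq {n : Type} [Fintype n] [DecidableEq n]
    (X : Matrix n n ℂ) : (Xᴴ * X).trace.re ≤ traceNorm X ^ 2 := by
  have hX := Matrix.isHermitian_conjTranspose_mul_self X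
  have h0 : ∀ i, 0 ≤ hX.eigenvalues i := (Matrix.posSemidef_conjTranspose_mul_self X).eigenvalues_nonneg
  rw [hX.trace_eq_sum_eigenvalues]
  have : (∑ i, (hX.eigenvalues i : ℂ)).re = ∑ i, Real.sqrt (hX.eigenvalues i) ^ 2 := by
    rw [Complex.re_sum]
    exact Finset.sum_congr rfl fun i _ => (Real.sq_sqrt (h0 i)).symm
  refine this.le.trans ?_
  exact Finset.sum_sq_le_sq_sum_of_nonneg fun i _ => Real.sqrt_nonneg _

theorem traceNorm_nonneg {n : Type} [Fintype n] [DecidableEq n] (X : Matrix n n ℂ) :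
    0 ≤ traceNorm X := Finset.sum_nonneg fun _ _ => Real.sqrt_nonneg _

theorem traceNorm_projection {n : Type} [Fintype n] [DecidableEq n] {P : Matrix n n ℂ}
    (hP : Pᴴ = P) (hP2 : P * P = P) : traceNorm P = P.trace.re := by
  have hX := Matrix.isHermitian_conjTranspose_mul_self P
  have hPP : Pᴴ * P = P := by rw [hP, hP2]
  have h : ∀ i, Real.sqrt (hX.eigenvalues i) = hX.eigenvalues i := by
    intro i
    set v := hX.eigenvectorBasis i with hv
    have h1 := hX.mulVec_eigenvectorBasis i
    have h2 : (Pᴴ * P) *ᵥ ((Pᴴ * P) *ᵥ ⇑v) = (Pᴴ * P) *ᵥ ⇑v := by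
      rw [Matrix.mulVec_mulVec, hPP, hP2]
    rw [h1, Matrix.mulVec_smul, h1, smul_smul] at h2
    have h3 : (⇑v : n → ℂ) ≠ 0 := by
      intro h0
      exact hX.eigenvectorBasis.orthonormal.ne_zero i (by ext j; exact congrFun h0 j)
    have h4 : hX.eigenvalues i * hX.eigenvalues i = hX.eigenvalues i := by
      have h5 : (hX.eigenvalues i * hX.eigenvalues i - hX.eigenvalues i) • (⇑v : n → ℂ) = 0 := by
        rw [sub_smul, h2, sub_self]
      exact sub_eq_zero.mp ((smul_eq_zero.mp h5).resolve_right h3)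
    have h0 : 0 ≤ hX.eigenvalues i := (Matrix.posSemidef_conjTranspose_mul_self P).eigenvalues_nonneg i
    conv_lhs => rw [← h4]
    exact Real.sqrt_mul_self h0
  have h2 := congrArg Complex.re hX.trace_eq_sum_eigenvalues
  rw [traceNorm, Finset.sum_congr rfl fun i _ => h i, ← congrArg Matrix.trace hPP, h2]
  simp

theorem trace_submatrix_equiv {m n : Type} [Fintype m] [Fintype n] (e : m ≃ n)
    (M : Matrix n n ℂ) : (M.submatrix e e).trace = M.trace :=
  e.sum_comp fun i => M i i

/-- Only a trivial reference system (`k = 1`) and a pure input are used, and the trace norm is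
weakened to the Frobenius norm. -/
theorem trace_sq_le_of_diamondNorm_le {Φ : QubitOp →ₗ[ℂ] QubitOp} {ε : ℝ} (hε : 0 ≤ ε)
    (h : diamondNorm Φ ≤ ENNReal.ofReal ε) {ρ : QubitOp} (hρ : ρᴴ = ρ) (hρ2 : ρ * ρ = ρ)
    (htr : ρ.trace = 1) : ((Φ ρ)ᴴ * Φ ρ).trace.re ≤ ε ^ 2 := by
  let e : Fin 2 × Fin 1 ≃ Fin 2 := Equiv.prodUnique _ _
  have h1 : traceNorm (ρ.submatrix e e) ≤ 1 := by
    rw [traceNorm_projection, trace_submatrix_equiv, htr, Complex.one_re]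
    · rw [Matrix.conjTranspose_submatrix, hρ]
    · rw [Matrix.submatrix_mul_equiv, hρ2]
  have h2 : ENNReal.ofReal (traceNorm (ampliate 1 Φ (ρ.submatrix e e))) ≤ ENNReal.ofReal ε :=
    (le_iSup₂_of_le (f := fun (k : ℕ) (X : Matrix (Fin 2 × Fin k) (Fin 2 × Fin k) ℂ) =>
      ⨆ (_ : traceNorm X ≤ 1), ENNReal.ofReal (traceNorm (ampliate k Φ X))) 1 (ρ.submatrix e e)
      (le_iSup_of_le h1 le_rfl)).trans h
  rw [ENNReal.ofReal_le_ofReal_iff hε] at h2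
  have h3 : ampliate 1 Φ (ρ.submatrix e e) = (Φ ρ).submatrix e e := rfl
  rw [h3] at h2
  have h4 := trace_conjTranspose_mul_self_le_sq ((Φ ρ).submatrix e e)
  rw [Matrix.conjTranspose_submatrix, Matrix.submatrix_mul_equiv, trace_submatrix_equiv] at h4
  exact h4.trans (pow_le_pow_left₀ (traceNorm_nonneg _) h2 2)

theorem norm_sesquilinear_sq_le (Y : QubitOp) {ψ : Fin 2 → ℂ} (hψ : ∑ i, ‖ψ i‖ ^ 2 = 1) :
    ‖star ψ ⬝ᵥ Y *ᵥ ψ‖ ^ 2 ≤ (Yᴴ * Y).trace.re := by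
  have h1 : (Yᴴ * Y).trace.re = ∑ x : Fin 2 × Fin 2, ‖Y x.1 x.2‖ ^ 2 := by
    rw [Fintype.sum_prod_type_right]
    simp only [Matrix.trace, Matrix.diag_apply, Matrix.mul_apply, Matrix.conjTranspose_apply,
      Complex.re_sum, Complex.star_def, Complex.conj_mul']
    simp [← Complex.ofReal_pow]
  have h2 : ∑ x : Fin 2 × Fin 2, (‖ψ x.1‖ * ‖ψ x.2‖) ^ 2 = 1 := by
    rw [Fintype.sum_prod_type]
    simp only [mul_pow, ← Finset.mul_sum, hψ, mul_one]
  have h3 : ‖star ψ ⬝ᵥ Y *ᵥ ψ‖ ≤ ∑ x : Fin 2 × Fin 2, ‖Y x.1 x.2‖ * (‖ψ x.1‖ * ‖ψ x.2‖) := by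
    rw [Fintype.sum_prod_type]
    simp only [dotProduct, Matrix.mulVec, Finset.mul_sum]
    refine (norm_sum_le _ _).trans (Finset.sum_le_sum fun i _ => (norm_sum_le _ _).trans
      (Finset.sum_le_sum fun j _ => ?_))
    rw [norm_mul, norm_mul, Pi.star_apply, norm_star]
    exact le_of_eq (by ring)
  calc ‖star ψ ⬝ᵥ Y *ᵥ ψ‖ ^ 2 ≤ (∑ x : Fin 2 × Fin 2, ‖Y x.1 x.2‖ * (‖ψ x.1‖ * ‖ψ x.2‖)) ^ 2 :=
        pow_le_pow_left₀ (norm_nonneg _) h3 2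
    _ ≤ _ := Finset.sum_mul_sq_le_sq_mul_sq _ _ _
    _ = _ := by rw [h1, h2, mul_one]

/-! ### Outcome probabilities of the branches of a protocol -/

theorem toRegister_mul (A B : QubitOp) : toRegister (A * B) = toRegister A * toRegister B := by
  ext a b
  change ∑ x, A (a 0) x * B x (b 0) = ∑ c : Qubits 1, A (a 0) (c 0) * B (c 0) (b 0)
  exact ((Equiv.funUnique (Fin 1) (Fin 2)).sum_comp fun x => A (a 0) x * B x (b 0)).symm

theorem toRegister_apply (A : QubitOp) (a b : Qubits 1) : toRegister A a b = A (a 0) (b 0) := rfl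

theorem toRegister_conjTranspose (A : QubitOp) : (toRegister A)ᴴ = toRegister Aᴴ := rfl

/-- The projectors onto the eigenspaces of a Pauli matrix; `false` is the eigenvalue `+1`. -/
def qubitProjector (s : Fin 4) (o : Bool) : QubitOp :=
  (1 / 2 : ℂ) • (1 + (if o then (-1 : ℂ) else 1) • pauliMatrix s)

theorem pauliProjector_one (s : Fin 4) (o : Bool) :
    pauliProjector (fun _ : Fin 1 => s) o = toRegister (qubitProjector s o) := by
  ext a b
  have h : (1 : Op 1) a b = (1 : QubitOp) (a 0) (b 0) := by
    simp [Matrix.one_apply, funext_iff]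
  have h' : pauliString (fun _ : Fin 1 => s) a b = pauliMatrix s (a 0) (b 0) := by
    simp [pauliString]
  rw [toRegister_apply, pauliProjector, qubitProjector, Matrix.smul_apply, Matrix.add_apply,
    Matrix.smul_apply, h, h']
  rfl

theorem qubitProjector_herm (s : Fin 4) (o : Bool) :
    (qubitProjector s o)ᴴ = qubitProjector s o := by
  rw [qubitProjector, Matrix.conjTranspose_smul, Matrix.conjTranspose_add,
    Matrix.conjTranspose_smul, pauliMatrix_family.herm _ ⟨s, rfl⟩]
  cases o <;> simp

theorem qubitProjector_sq (s : Fin 4) (o : Bool) :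
    qubitProjector s o * qubitProjector s o = qubitProjector s o := by
  have h := pauliMatrix_family.sq _ ⟨s, rfl⟩
  rw [qubitProjector]
  simp only [Matrix.smul_mul, Matrix.mul_smul, Matrix.add_mul, Matrix.mul_add, h, Matrix.one_mul,
    Matrix.mul_one]
  cases o <;> simp only [if_true, Bool.false_eq_true, if_false] <;> module

theorem conjBy_appendKet_ketZero :
    conjBy (appendKet 0 ketZero) 1 = toRegister !![1, 0; 0, 0] := by
  ext a b
  have h := conj_appendKet_append ketZero (1 : Op 0) (fun i => i.elim0) (fun i => i.elim0) a b
  have e : ∀ c : Qubits 1, (Fin.append (fun i : Fin 0 => i.elim0) c : Qubits (0 + 1)) = c := by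
    intro c
    ext i
    simp
  rw [e, e] at h
  refine h.trans ?_
  change _ = (!![1, 0; 0, 0] : QubitOp) (a 0) (b 0)
  simp only [ketZero]
  generalize a 0 = x
  generalize b 0 = y
  fin_cases x <;> fin_cases y <;> simp

/-- The eigenstates of `X` and `Z` can be prepared by measurements. -/
theorem prepare_eigenstate {s : Fin 4} (hs : s = 1 ∨ s = 3) (o : Bool) :
    conjBy (pauliProjector (fun _ : Fin 1 => s) o)
      (conjBy (pauliProjector (fun _ : Fin 1 => 2) false) (conjBy (appendKet 0 ketZero) 1)) =
    toRegister ((1 / 4 : ℂ) • qubitProjector s o) := by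
  -- Projecting first onto an eigenstate of `Y`, unbiased with respect to `X` and `Z`, makes every
  -- eigenstate reachable with the same probability `1/2 * 1/2`. Projecting `|0⟩` directly onto `Z =
  -- -1` would give zero.
  rw [conjBy_appendKet_ketZero, pauliProjector_one, pauliProjector_one]
  change toRegister _ * (toRegister _ * toRegister _ * (toRegister _)ᴴ) * (toRegister _)ᴴ = _
  simp only [toRegister_conjTranspose, ← toRegister_mul, qubitProjector_herm]
  congr 1
  rcases hs with rfl | rfl <;> cases o <;> ext i j <;> fin_cases i <;> fin_cases j <;>
    simp [qubitProjector, pauliMatrix, Matrix.mul_apply, Fin.sum_univ_two] <;> ring_nf <;>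
    simp <;> norm_num

/-- Prepending the preparation of the input eigenstate makes the branch a circuit on the empty
register, to which `IsStabEffect.outcome` applies. The common factor `1/4` of the preparation
cancels. -/
theorem Protocol.branch_outcome {r : ℕ} {Ψ : Ket r} (hΨ : ∑ a, ‖Ψ a‖ ^ 2 = 1) {c : ℕ}
    (hgap : StabilizerGap Ψ c) {s : Fin 4} (hs : s = 1 ∨ s = 3) (π : Protocol Ψ 1) {b : Branch 1}
    (hb : b ∈ π.branches) (o : Bool) {W : QubitOp} (hW : Wᴴ * W = 1)
    (hWs : W * pauliMatrix s * Wᴴ = pauliMatrix 3) (k : Fin 2) {σ : QubitOp}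
    (hσ : σ = W * b.run (toRegister (qubitProjector s o)) * Wᴴ) :
    σ k k = 0 ∨ σ k k = σ.trace / 2 ∨ ‖σ.trace‖ ≤ 2 ^ (c * b.consumed) * ‖σ k k‖ := by
  have H := (((π.isStabEffect_branches s b hb).measure (fun _ => s) o).measure
    (fun _ => 2) false).ancilla (n := 0)
  set τ := b.run (toRegister (qubitProjector s o)) with hτ
  have h1 := H.outcome hΨ hgap
  simp only [prepare_eigenstate hs o, map_smul, ← hτ, Matrix.trace_smul, Matrix.mul_smul,
    smul_eq_mul] at h1
  have htr : τ.trace = σ.trace := by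
    rw [hσ, Matrix.trace_mul_comm, ← Matrix.mul_assoc, hW, Matrix.one_mul]
  have hZ : (pauliMatrix s * τ).trace = (pauliMatrix 3 * σ).trace := by
    have h2 : pauliMatrix 3 * σ = W * (pauliMatrix s * τ) * Wᴴ := by
      rw [hσ, ← hWs]
      calc W * pauliMatrix s * Wᴴ * (W * τ * Wᴴ) = W * pauliMatrix s * (Wᴴ * W) * τ * Wᴴ := by
            simp only [Matrix.mul_assoc]
        _ = _ := by rw [hW]; simp only [Matrix.mul_assoc, Matrix.one_mul]
    rw [h2, Matrix.trace_mul_comm (W * _), ← Matrix.mul_assoc, hW, Matrix.one_mul]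
  have hZ' : (pauliMatrix 3 * σ).trace = σ 0 0 - σ 1 1 := by
    rw [Matrix.trace_fin_two, Matrix.mul_apply, Matrix.mul_apply]
    simp [pauliMatrix, sub_eq_add_neg]
  rw [htr, hZ, hZ'] at h1
  -- The sign selects the population: `2 σ k k` is the trace plus or minus the expectation of `Z`.
  have key : ∃ u : ℤˣ, 1 / 4 * σ.trace + u * (1 / 4 * (σ 0 0 - σ 1 1)) = 1 / 2 * σ k k := by
    rw [Matrix.trace_fin_two]
    fin_cases k
    · refine ⟨1, ?_⟩
      push_cast
      ring
    · refine ⟨-1, ?_⟩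
      push_cast
      ring
  obtain ⟨u, hu⟩ := key
  have h2 := h1 u
  rw [hu] at h2
  rcases h2 with h2 | h2 | h2
  · left
    linear_combination 2 * h2
  · right; left
    linear_combination 2 * h2
  · right; right
    have e1 : ‖(1 / 4 : ℂ) * σ.trace‖ = 1 / 4 * ‖σ.trace‖ := by rw [norm_mul]; norm_num
    have e2 : ‖(1 / 2 : ℂ) * σ k k / 2‖ = 1 / 4 * ‖σ k k‖ := by
      rw [norm_div, norm_mul]; norm_num; ring
    rw [e1, e2] at h2
    linarith

/-! ### Bounds on the number of consumed resource states -/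

theorem Branch.sum_map_run {A : Type} [AddCommMonoid A] (F : QubitOp →+ A) (l : List (Branch 1))
    (ρ : QubitOp) : (l.map fun b => F (b.run (toRegister ρ))).sum =
      F ((l.map fun b => b.run ∘ₗ toRegister).sum ρ) := by
  induction l with
  | nil => simp
  | cons b l ih => simp [ih]

theorem posSemidef_toRegister {ρ : QubitOp} (hρ : ρ.PosSemidef) : (toRegister ρ).PosSemidef :=
  hρ.submatrix fun a : Qubits 1 => a 0

theorem trace_toRegister (ρ : QubitOp) : (toRegister ρ).trace = ρ.trace :=
  (Equiv.funUnique (Fin 1) (Fin 2)).sum_comp fun x => ρ x x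

/-- Probability that fewer than `B` copies of `Ψ` are consumed, for unnormalized inputs. -/
def weightBelow {r : ℕ} {Ψ : Ket r} (π : Protocol Ψ 1) (B : ℝ) (ρ : QubitOp) : ℝ :=
  (π.branches.map fun b =>
    if (b.consumed : ℝ) < B then (b.run (toRegister ρ)).trace.re else 0).sum

theorem posSemidef_qubitProjector (s : Fin 4) (o : Bool) : (qubitProjector s o).PosSemidef := by
  have h := Matrix.posSemidef_conjTranspose_mul_self (qubitProjector s o)
  rwa [qubitProjector_herm, qubitProjector_sq] at h

theorem qubitProjector_add (s : Fin 4) : qubitProjector s false + qubitProjector s true = 1 := by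
  simp only [qubitProjector, if_true, Bool.false_eq_true, if_false]
  module

/-- The basis label of the eigenvector of `Z` for a measurement outcome. -/
def outcomeLabel (o : Bool) : Fin 2 := if o then 1 else 0

theorem qubitProjector_three (o : Bool) :
    qubitProjector 3 o = Matrix.single (outcomeLabel o) (outcomeLabel o) 1 := by
  cases o <;> ext i j <;> fin_cases i <;> fin_cases j <;>
    simp [qubitProjector, pauliMatrix, outcomeLabel, Matrix.single] <;> norm_num

/-- A unitary that maps the eigenbasis of the Pauli matrix `s` to the computational basis. -/
structure IsFrame (W : QubitOp) (s : Fin 4) : Prop where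
  conj_mul : Wᴴ * W = 1
  mul_conj : W * Wᴴ = 1
  conj_pauli : W * pauliMatrix s * Wᴴ = pauliMatrix 3

namespace IsFrame

variable {W : QubitOp} {s : Fin 4} (hW : IsFrame W s)
include hW

theorem trace_conj (M : QubitOp) : (W * M * Wᴴ).trace = M.trace := by
  rw [Matrix.trace_mul_comm, ← Matrix.mul_assoc, hW.conj_mul, Matrix.one_mul]

theorem conj_mul_conj (M N : QubitOp) : (W * M * Wᴴ) * (W * N * Wᴴ) = W * (M * N) * Wᴴ := by
  calc (W * M * Wᴴ) * (W * N * Wᴴ) = W * M * (Wᴴ * W) * N * Wᴴ := by simp only [Matrix.mul_assoc]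
    _ = _ := by rw [hW.conj_mul]; simp only [Matrix.mul_assoc, Matrix.one_mul]

omit hW in
theorem conj_conjTranspose (M : QubitOp) : (W * M * Wᴴ)ᴴ = W * Mᴴ * Wᴴ := by
  simp only [Matrix.conjTranspose_mul, Matrix.conjTranspose_conjTranspose, Matrix.mul_assoc]

theorem conj_projector (o : Bool) : W * qubitProjector s o * Wᴴ =
    Matrix.single (outcomeLabel o) (outcomeLabel o) 1 := by
  rw [← qubitProjector_three, qubitProjector, qubitProjector, ← hW.conj_pauli, Matrix.mul_smul,
    Matrix.smul_mul, Matrix.mul_add, Matrix.add_mul, Matrix.mul_one, hW.mul_conj, Matrix.mul_smul,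
    Matrix.smul_mul]

theorem trace_projector (o : Bool) : (qubitProjector s o).trace = 1 := by
  rw [← hW.trace_conj, hW.conj_projector, Matrix.trace_single_eq_same]

end IsFrame

theorem sum_norm_column {U : QubitOp} (hU : Uᴴ * U = 1) (j : Fin 2) :
    ∑ i, ‖U i j‖ ^ 2 = 1 := by
  have h := congrFun (congrFun hU j) j
  rw [Matrix.mul_apply, Matrix.one_apply_eq] at h
  have h2 : ((∑ i, ‖U i j‖ ^ 2 : ℝ) : ℂ) = 1 := by
    rw [← h, Complex.ofReal_sum]
    refine Finset.sum_congr rfl fun i _ => ?_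
    rw [Matrix.conjTranspose_apply, Complex.star_def, Complex.conj_mul', Complex.ofReal_pow]
  exact_mod_cast h2

theorem norm_sq_off_diagonal {U : QubitOp} (hU : Uᴴ * U = 1) : ‖U 1 0‖ ^ 2 = ‖U 0 1‖ ^ 2 := by
  have hU' : U * Uᴴ = 1 := mul_eq_one_comm.mp hU
  have h1 := sum_norm_column hU 0
  have h2 := sum_norm_column (U := Uᴴ) (by rwa [Matrix.conjTranspose_conjTranspose]) 0
  simp only [Fin.sum_univ_two, Matrix.conjTranspose_apply, norm_star] at h1 h2
  linarith

/-- The average output of an approximating protocol has small infidelity. -/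
theorem infidelity_channel_le {r : ℕ} {Ψ : Ket r} (hΨ : ∑ a, ‖Ψ a‖ ^ 2 = 1) {W : QubitOp}
    {s : Fin 4} (hW : IsFrame W s) {U : QubitOp} (hU : Uᴴ * U = 1) {ε : ℝ} (hε : 0 ≤ ε)
    {π : Protocol Ψ 1} (hπ : π.Approximates U ε) (o : Bool) :
    infidelity (W * π.channel (qubitProjector s o) * Wᴴ)
      (fun i => (W * U * Wᴴ) i (outcomeLabel o)) ≤ ε := by
  set ψ : Fin 2 → ℂ := fun i => (W * U * Wᴴ) i (outcomeLabel o) with hψdef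
  have hU' : (W * U * Wᴴ)ᴴ * (W * U * Wᴴ) = 1 := by
    rw [IsFrame.conj_conjTranspose, hW.conj_mul_conj, hU, Matrix.mul_one, hW.mul_conj]
  have hψ : ∑ i, ‖ψ i‖ ^ 2 = 1 := sum_norm_column hU' _
  set ρ := qubitProjector s o with hρ
  set Y := (π.channel - conjBy U) ρ with hY
  have hfrob : (Yᴴ * Y).trace.re ≤ ε ^ 2 := trace_sq_le_of_diamondNorm_le hε hπ
    (qubitProjector_herm s o) (qubitProjector_sq s o) (hW.trace_projector o)
  have hE : W * π.channel ρ * Wᴴ = W * Y * Wᴴ + W * (U * ρ * Uᴴ) * Wᴴ := by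
    rw [← Matrix.add_mul, ← Matrix.mul_add]
    congr 2
    exact (sub_add_cancel (π.channel ρ) (U * ρ * Uᴴ)).symm
  have htarget : W * (U * ρ * Uᴴ) * Wᴴ = Matrix.vecMulVec ψ (star ψ) := by
    rw [← hW.conj_mul_conj, ← hW.conj_mul_conj, hW.conj_projector, ← IsFrame.conj_conjTranspose]
    rw [hψdef]
    generalize W * U * Wᴴ = V
    ext i j
    cases o <;> simp [outcomeLabel, Matrix.vecMulVec_apply, Matrix.mul_apply, Matrix.single]
  have hnorm : star ψ ⬝ᵥ ψ = 1 := by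
    have := congrArg Complex.ofReal hψ
    rw [Complex.ofReal_sum, Complex.ofReal_one] at this
    rw [← this]
    refine Finset.sum_congr rfl fun i _ => ?_
    rw [Pi.star_apply, Complex.star_def, Complex.conj_mul', Complex.ofReal_pow]
  have htr : (W * π.channel ρ * Wᴴ).trace = 1 := by
    rw [hW.trace_conj, Protocol.channel,
      ← Matrix.traceAddMonoidHom_apply, ← Branch.sum_map_run]
    exact (π.sum_trace_run hΨ _).trans ((trace_toRegister _).trans (hW.trace_projector o))
  -- The averaged output has trace one and the target has overlap one with `ψ`, so only the error
  -- term `Y` survives.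
  have h1 : infidelity (W * π.channel ρ * Wᴴ) ψ = -(star ψ ⬝ᵥ (W * Y * Wᴴ) *ᵥ ψ).re := by
    rw [infidelity, htr, hE, htarget, Matrix.add_mulVec, dotProduct_add, Matrix.vecMulVec_mulVec,
      hnorm]
    simp [hnorm]
  have h2 := norm_sesquilinear_sq_le (W * Y * Wᴴ) hψ
  rw [IsFrame.conj_conjTranspose, hW.conj_mul_conj, hW.trace_conj] at h2
  rw [h1]
  refine (neg_le_abs _).trans ((Complex.abs_re_le_norm _).trans ?_)
  exact abs_le_of_sq_le_sq' (h2.trans hfrob) hε |>.2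

/-- Infidelity is additive over the branches. Each cheap branch contributes at least `4t²` times its
weight, and the others contribute nonnegatively. -/
theorem weightBelow_projector_le {r : ℕ} {Ψ : Ket r} (hΨ : ∑ a, ‖Ψ a‖ ^ 2 = 1) {c : ℕ}
    (hgap : StabilizerGap Ψ c) {W : QubitOp} {s : Fin 4} (hs : s = 1 ∨ s = 3) (hW : IsFrame W s)
    {U : QubitOp} (hU : Uᴴ * U = 1) {ε : ℝ} (hε : 0 ≤ ε) {t : ℝ} (ht : 0 < t) (ht16 : 16 * t ≤ 1)
    (hq1 : 2 * t ≤ ‖(W * U * Wᴴ) 0 1‖ ^ 2) (hq2 : ‖(W * U * Wᴴ) 0 1‖ ^ 2 ≤ 6 * t) {B : ℝ}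
    (hB : ∀ N : ℕ, (N : ℝ) < B → 2 ^ (c * N) * (8 * t) ≤ 1)
    {π : Protocol Ψ 1} (hπ : π.Approximates U ε) (o : Bool) :
    4 * t ^ 2 * weightBelow π B (qubitProjector s o) ≤ ε := by
  set ψ : Fin 2 → ℂ := fun i => (W * U * Wᴴ) i (outcomeLabel o) with hψdef
  have hU' : (W * U * Wᴴ)ᴴ * (W * U * Wᴴ) = 1 := by
    rw [IsFrame.conj_conjTranspose, hW.conj_mul_conj, hU, Matrix.mul_one, hW.mul_conj]
  have hψ : ∑ i, ‖ψ i‖ ^ 2 = 1 := sum_norm_column hU' _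
  have hq : ‖ψ (outcomeLabel !o)‖ ^ 2 = ‖(W * U * Wᴴ) 0 1‖ ^ 2 := by
    cases o
    · exact norm_sq_off_diagonal hU'
    · rfl
  let F : QubitOp →+ ℝ :=
    { toFun := fun M => infidelity (W * M * Wᴴ) ψ
      map_zero' := by simp [infidelity]
      map_add' := fun M M' => by
        simp only [infidelity, Matrix.mul_add, Matrix.add_mul, Matrix.trace_add, Matrix.add_mulVec,
          dotProduct_add, Complex.sub_re, Complex.add_re]
        ring }
  refine le_trans ?_ (infidelity_channel_le hΨ hW hU hε hπ o)
  change _ ≤ F (π.channel (qubitProjector s o))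
  rw [Protocol.channel, ← Branch.sum_map_run, weightBelow, ← List.sum_map_mul_left]
  refine List.sum_le_sum fun b hb => ?_
  change _ ≤ infidelity (W * b.run (toRegister (qubitProjector s o)) * Wᴴ) ψ
  have htr : (b.run (toRegister (qubitProjector s o))).trace =
      (W * b.run (toRegister (qubitProjector s o)) * Wᴴ).trace := (hW.trace_conj _).symm
  rw [htr]
  have hpos : (W * b.run (toRegister (qubitProjector s o)) * Wᴴ).PosSemidef :=
    (π.posSemidef_run b hb _ (posSemidef_toRegister
      (posSemidef_qubitProjector s o))).mul_mul_conjTranspose_same _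
  have hout := π.branch_outcome hΨ hgap hs hb o hW.conj_mul hW.conj_pauli (outcomeLabel !o) rfl
  set σ := W * b.run (toRegister (qubitProjector s o)) * Wᴴ with hσ
  obtain ⟨hD0, hD⟩ := infidelity_bound hpos hψ
  split_ifs with hN
  swap
  · rwa [mul_zero]
  have hT := Complex.le_def.mp hpos.trace_nonneg
  have hp := Complex.le_def.mp (hpos.diag_nonneg (i := outcomeLabel !o))
  have hD' := hD (outcomeLabel !o)
  rw [hq] at hD'
  set T := σ.trace.re with hTdef
  set p := (σ (outcomeLabel !o) (outcomeLabel !o)).re with hpdef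
  set q := ‖(W * U * Wᴴ) 0 1‖ ^ 2 with hqdef
  set D := infidelity σ ψ with hDdef
  have hT0 : 0 ≤ T := hT.1
  have hp0 : 0 ≤ p := hp.1
  have hnT : ‖σ.trace‖ = T := by
    rw [show σ.trace = (T : ℂ) from Complex.ext rfl hT.2.symm, Complex.norm_real,
      Real.norm_of_nonneg hT0]
  have hnp : ‖σ (outcomeLabel !o) (outcomeLabel !o)‖ = p := by
    rw [show σ (outcomeLabel !o) (outcomeLabel !o) = (p : ℂ) from Complex.ext rfl hp.2.symm,
      Complex.norm_real, Real.norm_of_nonneg hp0]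
  -- With `2t ≤ q ≤ 6t`: the value `p = 0` misses by `qT`; `p = T/2` misses by at least `(8t - 6t)T`
  -- because `16t ≤ 1`; and `p ≥ 8tT` misses by at least `2tT`.
  have hgap2 : 2 * t * T ≤ |p - q * T| := by
    rcases hout with h | h | h
    · have : p = 0 := by rw [hpdef, h, Complex.zero_re]
      rw [this, zero_sub, abs_neg, abs_of_nonneg (by positivity)]
      exact mul_le_mul_of_nonneg_right hq1 hT0
    · have : p = T / 2 := by rw [hpdef, h]; simp [hTdef]
      refine le_trans ?_ (le_abs_self _)
      rw [this]
      nlinarith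
    · refine le_trans ?_ (le_abs_self _)
      rw [hnT, hnp] at h
      have h8 := hB _ hN
      have h3 : 8 * t * T ≤ p := by
        calc 8 * t * T ≤ 8 * t * (2 ^ (c * b.consumed) * p) := by gcongr
          _ = (2 ^ (c * b.consumed) * (8 * t)) * p := by ring
          _ ≤ 1 * p := by gcongr
          _ = p := one_mul p
      nlinarith
  have hsq : (2 * t * T) ^ 2 ≤ T * D := by
    refine le_trans ?_ hD'
    rw [← sq_abs (p - q * T)]
    exact pow_le_pow_left₀ (by positivity) hgap2 2
  rcases hT0.eq_or_lt with h | h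
  · rw [← h, mul_zero]; exact hD0
  · refine le_of_mul_le_mul_left ?_ h
    linarith

theorem weightBelow_le_add {r : ℕ} {Ψ : Ket r} (π : Protocol Ψ 1) (B : ℝ) (s : Fin 4)
    {ρ : QubitOp} (hρ : IsDensity ρ) : weightBelow π B ρ ≤
      weightBelow π B (qubitProjector s false) + weightBelow π B (qubitProjector s true) := by
  have hcomp : (1 - ρ).PosSemidef := by
    -- For a trace-one qubit operator the complement is the spin flip, which is manifestly positive.
    have h : 1 - ρ = !![0, 1; -1, 0] * ρᵀ * (!![0, 1; -1, 0] : QubitOp)ᴴ := by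
      have htr := hρ.2
      rw [Matrix.trace_fin_two] at htr
      ext i j
      fin_cases i <;> fin_cases j <;>
        simp [Matrix.mul_apply, Fin.sum_univ_two, Matrix.vecMul, dotProduct] <;>
        linear_combination -htr
    rw [h]
    exact hρ.1.transpose.mul_mul_conjTranspose_same _
  rw [weightBelow, weightBelow, weightBelow, ← List.sum_map_add]
  refine List.sum_le_sum fun b hb => ?_
  split_ifs
  · have h := π.posSemidef_run b hb _ (posSemidef_toRegister hcomp)
    have h1 := (Complex.le_def.mp h.trace_nonneg).1
    rw [← qubitProjector_add s, map_sub, map_add, map_sub, map_add, Matrix.trace_sub,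
      Matrix.trace_add, Complex.sub_re, Complex.add_re, Complex.zero_re] at h1
    linarith
  · simp

/-- With `t² = Cε` each eigenprojector gives weight at most `1/(4C)` to the cheap branches. Hence
any input gives at most `1/(2C)`, below the allowed `1/C`. -/
theorem consumesWithProb_of_gap {r : ℕ} {Ψ : Ket r} (hΨ : ∑ a, ‖Ψ a‖ ^ 2 = 1) {c : ℕ}
    (hgap : StabilizerGap Ψ c) {W : QubitOp} {s : Fin 4} (hs : s = 1 ∨ s = 3) (hW : IsFrame W s)
    {U : QubitOp} (hU : Uᴴ * U = 1) {C ε : ℝ} (hC : 1 < C) (hε : 0 < ε)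
    (hCε : 16 * Real.sqrt (C * ε) ≤ 1)
    (hq1 : 2 * Real.sqrt (C * ε) ≤ ‖(W * U * Wᴴ) 0 1‖ ^ 2)
    (hq2 : ‖(W * U * Wᴴ) 0 1‖ ^ 2 ≤ 6 * Real.sqrt (C * ε)) {B : ℝ}
    (hB : ∀ N : ℕ, (N : ℝ) < B → 2 ^ (c * N) * (8 * Real.sqrt (C * ε)) ≤ 1) :
    ConsumesWithProb Ψ U ε ((C - 1) / C) B := by
  intro π hπ ρ hρ
  have hC0 : 0 < C := by linarith
  have ht : 0 < Real.sqrt (C * ε) := Real.sqrt_pos.mpr (by positivity)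
  have hw : ∀ o, 4 * C * weightBelow π B (qubitProjector s o) ≤ 1 := by
    intro o
    have h := weightBelow_projector_le hΨ hgap hs hW hU hε.le ht hCε hq1 hq2 hB hπ o
    rw [Real.sq_sqrt (by positivity)] at h
    refine le_of_mul_le_mul_right ?_ hε
    linarith
  have hsum : π.probConsumed ρ (fun N => B ≤ (N : ℝ)) + weightBelow π B ρ = 1 := by
    have h := congrArg Complex.re (π.sum_trace_run hΨ (toRegister ρ))
    rw [trace_toRegister, hρ.2, Complex.one_re] at h
    rw [← h, Protocol.probConsumed, weightBelow, ← List.sum_map_add]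
    have h2 : ∀ l : List (Branch 1),
        Complex.re (l.map fun b : Branch 1 => (b.run (toRegister ρ)).trace).sum =
          (l.map fun b : Branch 1 => (b.run (toRegister ρ)).trace.re).sum := by
      intro l
      induction l with
      | nil => simp
      | cons b l ih => simp [ih]
    rw [h2]
    refine congrArg List.sum (List.map_congr_left fun b _ => ?_)
    by_cases hb : B ≤ (b.consumed : ℝ)
    · rw [if_pos hb, if_neg (not_lt.mpr hb), add_zero]
    · rw [if_neg hb, if_pos (not_le.mp hb), zero_add]
  have hle := weightBelow_le_add π B s hρ
  have h1 := hw false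
  have h2 := hw true
  rw [div_le_iff₀ hC0]
  nlinarith [mul_le_mul_of_nonneg_left hle hC0.le]

/-- Markov's inequality; for `b ≤ 0` the claim is only nonnegativity of the expectation. -/
theorem ConsumesWithProb.onAverage {r : ℕ} {Ψ : Ket r} {U : QubitOp} {ε p b : ℝ} (hp : 0 ≤ p)
    (h : ConsumesWithProb Ψ U ε p b) : ConsumesOnAverage Ψ U ε (p * b) := by
  intro π hπ ρ hρ
  have hT : ∀ x ∈ π.branches, 0 ≤ (x.run (toRegister ρ)).trace.re := fun x hx =>
    (Complex.le_def.mp (π.posSemidef_run x hx _ (posSemidef_toRegister hρ.1)).trace_nonneg).1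
  rcases le_or_gt b 0 with hb | hb
  · refine (mul_nonpos_of_nonneg_of_nonpos hp hb).trans (List.sum_nonneg ?_)
    intro y hy
    obtain ⟨x, hx, rfl⟩ := List.mem_map.mp hy
    exact mul_nonneg (Nat.cast_nonneg _) (hT x hx)
  · refine (mul_le_mul_of_nonneg_right (h π hπ ρ hρ) hb.le).trans ?_
    rw [Protocol.probConsumed, Protocol.expectConsumed, ← List.sum_map_mul_right]
    refine List.sum_le_sum fun x hx => ?_
    split_ifs with hN
    · rw [mul_comm]
      exact mul_le_mul_of_nonneg_right hN (hT x hx)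
    · rw [zero_mul]
      exact mul_nonneg (Nat.cast_nonneg _) (hT x hx)

/-! ### The main theorem -/

theorem two_pow_mul_sqrt_le_one {C ε : ℝ} (hC : 0 < C) (hε : 0 < ε) {c N : ℕ}
    (h : 2 * c * N + 6 < Real.logb 2 (1 / ε) - Real.logb 2 C) :
    2 ^ (c * N) * (8 * Real.sqrt (C * ε)) ≤ 1 := by
  -- Squaring removes the root; the `6` is the exponent of `8² = 2 ^ 6`. With `c = 3, 4` dividing by
  -- `2c` yields the constant terms `1` and `3/4` of the bounds.
  have h1 : ((2 * (c * N) + 6 : ℕ) : ℝ) < Real.logb 2 (1 / (C * ε)) := by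
    rw [mul_comm C, ← div_div, Real.logb_div (by positivity) hC.ne']
    push_cast
    linarith
  rw [Real.lt_logb_iff_rpow_lt (by norm_num) (by positivity), Real.rpow_natCast,
    lt_div_iff₀ (by positivity), pow_add, pow_mul'] at h1
  refine abs_le_of_sq_le_sq' ?_ zero_le_one |>.2
  rw [mul_pow, mul_pow, Real.sq_sqrt (by positivity)]
  linarith

theorem sixteen_mul_sqrt_le_one {C ε : ℝ} (hC : 1 < C) (hε : 0 < ε) (h : ε < 1 / (2 ^ 8 * C)) :
    16 * Real.sqrt (C * ε) ≤ 1 := by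
  have hC0 : 0 < C := by linarith
  rw [lt_div_iff₀ (by positivity)] at h
  refine abs_le_of_sq_le_sq' ?_ zero_le_one |>.2
  rw [mul_pow, Real.sq_sqrt (by positivity)]
  linarith

theorem synthesisBounds_of_frame {W : QubitOp} {s : Fin 4} (hs : s = 1 ∨ s = 3)
    (hW : IsFrame W s) {U : QubitOp} (hU : U ∈ Matrix.unitaryGroup (Fin 2) ℂ) {C ε : ℝ}
    (hC : 1 < C) (hε : 0 < ε) (hCε : ε < 1 / (2 ^ 8 * C))
    (hq1 : 2 * Real.sqrt (C * ε) ≤ ‖(W * U * Wᴴ) 0 1‖ ^ 2)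
    (hq2 : ‖(W * U * Wᴴ) 0 1‖ ^ 2 ≤ 6 * Real.sqrt (C * ε)) : SynthesisBounds C ε U := by
  have hC0 : 0 < C := by linarith
  have h16 := sixteen_mul_sqrt_le_one hC hε hCε
  have hU' : Uᴴ * U = 1 := Matrix.mem_unitaryGroup_iff'.mp hU
  have hp : 0 ≤ (C - 1) / C := div_nonneg (by linarith) hC0.le
  have hT : ConsumesWithProb ketT U ε ((C - 1) / C) (boundT C ε) :=
    consumesWithProb_of_gap sum_norm_ketT stabilizerGap_T hs hW hU' hC hε h16 hq1 hq2
      fun N hN => two_pow_mul_sqrt_le_one hC0 hε (by rw [boundT] at hN; push_cast; linarith)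
  have hCCZ : ConsumesWithProb ketCCZ U ε ((C - 1) / C) (boundCCZ C ε) :=
    consumesWithProb_of_gap sum_norm_ketCCZ stabilizerGap_CCZ hs hW hU' hC hε h16 hq1 hq2
      fun N hN => two_pow_mul_sqrt_le_one hC0 hε (by rw [boundCCZ] at hN; push_cast; linarith)
  have hCS : ConsumesWithProb ketCS U ε ((C - 1) / C) (boundCS C ε) :=
    consumesWithProb_of_gap sum_norm_ketCS stabilizerGap_CS hs hW hU' hC hε h16 hq1 hq2
      fun N hN => two_pow_mul_sqrt_le_one hC0 hε (by rw [boundCS] at hN; push_cast; linarith)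
  exact ⟨⟨hT, hCCZ, hCS⟩, hT.onAverage hp, hCCZ.onAverage hp, hCS.onAverage hp⟩

/-! ### Frames for `Z` and `X`, and explicit target unitaries -/

theorem isFrame_one : IsFrame 1 3 where
  conj_mul := by simp
  mul_conj := by simp
  conj_pauli := by simp

/-- The Hadamard gate. -/
def hadamardGate : QubitOp := (1 / (Real.sqrt 2 : ℂ)) • !![1, 1; 1, -1]

theorem inv_sqrt_two_mul_self : (1 / (Real.sqrt 2 : ℂ)) * (1 / (Real.sqrt 2 : ℂ)) = 1 / 2 := by
  rw [div_mul_div_comm, ← Complex.ofReal_mul, Real.mul_self_sqrt (by norm_num)]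
  norm_num

theorem hadamardGate_conjTranspose : hadamardGateᴴ = hadamardGate := by
  rw [hadamardGate, Matrix.conjTranspose_smul, Complex.star_def, map_div₀, map_one,
    Complex.conj_ofReal]
  congr 1
  ext i j
  fin_cases i <;> fin_cases j <;> simp

theorem hadamardGate_mul_mul (M : QubitOp) : hadamardGate * M * hadamardGateᴴ =
    (1 / 2 : ℂ) • (!![1, 1; 1, -1] * M * !![1, 1; 1, -1]) := by
  rw [hadamardGate_conjTranspose, hadamardGate, Matrix.smul_mul, Matrix.smul_mul, Matrix.mul_smul,
    smul_smul, inv_sqrt_two_mul_self]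

theorem isFrame_hadamardGate : IsFrame hadamardGate 1 := by
  have h : hadamardGate * hadamardGateᴴ = 1 := by
    have := hadamardGate_mul_mul 1
    rw [Matrix.mul_one, Matrix.mul_one] at this
    rw [this]
    ext i j
    fin_cases i <;> fin_cases j <;> simp <;> norm_num
  refine ⟨mul_eq_one_comm.mp h, h, ?_⟩
  rw [hadamardGate_mul_mul]
  ext i j
  fin_cases i <;> fin_cases j <;>
    simp [pauliMatrix] <;> norm_num

theorem exists_diagonal_synthesisBounds {C ε : ℝ} (hC : 1 < C) (hε : 0 < ε)
    (hCε : ε < 1 / (2 ^ 8 * C)) :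
    ∃ U ∈ Matrix.unitaryGroup (Fin 2) ℂ, U.IsDiag ∧ SynthesisBounds C ε U := by
  have h16 := sixteen_mul_sqrt_le_one hC hε hCε
  have ht : 0 ≤ Real.sqrt (C * ε) := Real.sqrt_nonneg _
  set t := Real.sqrt (C * ε) with htdef
  -- For `|z| = 1` the flip probability of `diag(1, z)` in the `X` basis is `(1 - Re z) / 2`; this
  -- choice makes it `4t`, the middle of the allowed interval.
  set z : ℂ := ⟨1 - 8 * t, Real.sqrt (1 - (1 - 8 * t) ^ 2)⟩ with hz
  have hsq : Real.sqrt (1 - (1 - 8 * t) ^ 2) * Real.sqrt (1 - (1 - 8 * t) ^ 2) =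
      1 - (1 - 8 * t) ^ 2 := Real.mul_self_sqrt (by nlinarith)
  have hzz : z * star z = 1 := by
    rw [Complex.star_def, Complex.mul_conj, Complex.normSq_apply]
    simp only [hz]
    rw [hsq]
    norm_cast
    ring
  have hU : Matrix.diagonal ![1, z] ∈ Matrix.unitaryGroup (Fin 2) ℂ := by
    rw [Matrix.mem_unitaryGroup_iff, Matrix.star_eq_conjTranspose, Matrix.diagonal_conjTranspose,
      Matrix.diagonal_mul_diagonal, ← Matrix.diagonal_one]
    congr 1
    ext i
    fin_cases i
    · simp
    · exact hzz
  have hq : ‖(hadamardGate * Matrix.diagonal ![1, z] * hadamardGateᴴ) 0 1‖ ^ 2 = 4 * t := by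
    have h1 : (hadamardGate * Matrix.diagonal ![1, z] * hadamardGateᴴ) 0 1 = (1 - z) / 2 := by
      rw [hadamardGate_mul_mul]
      simp [Matrix.mul_apply, Fin.sum_univ_two, Matrix.vecMul, dotProduct]
      ring
    rw [h1, norm_div, div_pow, Complex.sq_norm, Complex.normSq_apply]
    simp only [hz, Complex.sub_re, Complex.sub_im, Complex.one_re, Complex.one_im,
      Complex.norm_two]
    linear_combination hsq / 4
  exact ⟨_, hU, Matrix.isDiag_diagonal _, synthesisBounds_of_frame (Or.inl rfl)
    isFrame_hadamardGate hU hC hε hCε (by rw [hq]; linarith) (by rw [hq]; linarith)⟩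

theorem exists_unitary_of_transition {t : ℝ} (ht0 : 0 ≤ t) (ht1 : t ≤ 1) :
    ∃ U ∈ Matrix.unitaryGroup (Fin 2) ℂ, ‖U 0 1‖ ^ 2 = t := by
  have h1 : (Real.sqrt t : ℂ) * Real.sqrt t = t := by
    rw [← Complex.ofReal_mul, Real.mul_self_sqrt ht0]
  have h2 : (Real.sqrt (1 - t) : ℂ) * Real.sqrt (1 - t) = 1 - t := by
    rw [← Complex.ofReal_mul, Real.mul_self_sqrt (by linarith)]
    push_cast
    ring
  refine ⟨!![(Real.sqrt (1 - t) : ℂ), -(Real.sqrt t : ℂ); (Real.sqrt t : ℂ),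
    (Real.sqrt (1 - t) : ℂ)], ?_, ?_⟩
  · rw [Matrix.mem_unitaryGroup_iff, Matrix.star_eq_conjTranspose]
    ext i j
    fin_cases i <;> fin_cases j <;> simp [Matrix.mul_apply, Fin.sum_univ_two, h1, h2, mul_comm]
  · simp [Real.sq_sqrt ht0]

/-- This is the loss from the factor `(C - 1) / C`, and accounts for `4/3 = 1 + 1/3` in the last
bound. The tangent-line estimate `exp y ≥ 1 + y` gives `2 ^ x ≥ 2e·log 2·(x - 1)`, and `2e·log 2 >
3`. -/
theorem mul_two_rpow_neg_le (x : ℝ) : (x - 1) * (2 : ℝ) ^ (-x) ≤ 1 / 3 := by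
  have h1 : (3 : ℝ) * (x - 1) ≤ 2 ^ x := by
    rcases le_or_gt x 1 with hx | hx
    · have : (0 : ℝ) < 2 ^ x := by positivity
      linarith
    · have h2 : (2 : ℝ) ^ x = 2 * (Real.exp 1 * Real.exp (Real.log 2 * (x - 1) - 1)) := by
        rw [← Real.exp_add, add_sub_cancel, Real.rpow_def_of_pos (by norm_num), mul_sub, mul_one,
          Real.exp_sub, Real.exp_log (by norm_num)]
        ring
      have h3 := Real.add_one_le_exp (Real.log 2 * (x - 1) - 1)
      have h4 := Real.log_two_gt_d9
      have h5 : (2 : ℝ) * (Real.exp 1 * (0.69 * (x - 1))) ≤ 2 ^ x := by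
        rw [h2]
        gcongr
        nlinarith
      nlinarith [Real.exp_one_gt_d9]
  rw [Real.rpow_neg (by norm_num), ← div_eq_mul_inv, div_le_iff₀ (by positivity)]
  linarith

theorem exists_diagonal_average_bound {ε : ℝ} (hε : 0 < ε) :
    ∃ U ∈ Matrix.unitaryGroup (Fin 2) ℂ, U.IsDiag ∧
      ConsumesOnAverage ketT U ε (1 / 7 * Real.logb 2 (1 / ε) - 4 / 3) := by
  rcases le_or_gt (1 / 7 * Real.logb 2 (1 / ε) - 4 / 3) 0 with h | h
  · refine ⟨1, one_mem _, Matrix.isDiag_one, fun π _ ρ hρ => h.trans (List.sum_nonneg ?_)⟩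
    intro y hy
    obtain ⟨x, hx, rfl⟩ := List.mem_map.mp hy
    exact mul_nonneg (Nat.cast_nonneg _) (Complex.le_def.mp
      (π.posSemidef_run x hx _ (posSemidef_toRegister hρ.1)).trace_nonneg).1
  · set x := 1 / 7 * Real.logb 2 (1 / ε) with hx
    have hL : Real.logb 2 (1 / ε) = 7 * x := by rw [hx]; ring
    have hε' : ε = 2 ^ (-(7 * x)) := by
      rw [← hL, one_div, Real.logb_inv, neg_neg, Real.rpow_logb (by norm_num) (by norm_num) hε]
    -- With `ε = 2 ^ (-7x)` this gives `boundT C ε = 7x/6 - x/6 - 1 = x - 1`. The condition on `ε`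
    -- reads `2 ^ (8 - 6x) < 1`, which holds because `x > 4/3` in this case.
    set C : ℝ := 2 ^ x with hCdef
    have hC0 : 0 < C := by positivity
    have hC : 1 < C := Real.one_lt_rpow (by norm_num) (by linarith)
    have hCε : ε < 1 / (2 ^ 8 * C) := by
      rw [lt_div_iff₀ (by positivity), hε', hCdef, ← Real.rpow_natCast, ← Real.rpow_add (by norm_num),
        ← Real.rpow_add (by norm_num)]
      refine Real.rpow_lt_one_of_one_lt_of_neg (by norm_num) ?_
      push_cast
      linarith
    obtain ⟨U, hU, hdiag, -, hav, -⟩ := exists_diagonal_synthesisBounds hC hε hCε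
    refine ⟨U, hU, hdiag, fun π hπ ρ hρ => le_trans ?_ (hav π hπ ρ hρ)⟩
    have hb : boundT C ε = x - 1 := by
      rw [boundT, hL, hCdef, Real.logb_rpow (by norm_num) (by norm_num)]
      ring
    have h3 := mul_two_rpow_neg_le x
    have h4 : (C - 1) / C = 1 - 2 ^ (-x) := by
      rw [Real.rpow_neg (by norm_num), sub_div, div_self hC0.ne', one_div]
    rw [hb, h4]
    linarith

end

theorem mainTheorem1 :
    (∀ C ε : ℝ, 1 < C → 0 < ε → ε < 1 / (2 ^ 8 * C) →
      (∀ U ∈ Matrix.unitaryGroup (Fin 2) ℂ,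
        2 * Real.sqrt (C * ε) ≤ ‖U 0 1‖ ^ 2 → ‖U 0 1‖ ^ 2 ≤ 6 * Real.sqrt (C * ε) →
          SynthesisBounds C ε U) ∧
      (∃ U ∈ Matrix.unitaryGroup (Fin 2) ℂ,
        2 * Real.sqrt (C * ε) ≤ ‖U 0 1‖ ^ 2 ∧ ‖U 0 1‖ ^ 2 ≤ 6 * Real.sqrt (C * ε)) ∧
      (∃ U ∈ Matrix.unitaryGroup (Fin 2) ℂ, U.IsDiag ∧ SynthesisBounds C ε U)) ∧
    (∀ ε : ℝ, 0 < ε →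
      ∃ U ∈ Matrix.unitaryGroup (Fin 2) ℂ, U.IsDiag ∧
        ConsumesOnAverage ketT U ε (1 / 7 * Real.logb 2 (1 / ε) - 4 / 3)) := by
  refine ⟨fun C ε hC hε hCε => ⟨fun U hU hq1 hq2 => ?_, ?_,
    exists_diagonal_synthesisBounds hC hε hCε⟩, fun ε hε => exists_diagonal_average_bound hε⟩
  · exact synthesisBounds_of_frame (Or.inr rfl) isFrame_one hU hC hε hCε (by simpa using hq1)
      (by simpa using hq2)
  · have h16 := sixteen_mul_sqrt_le_one hC hε hCε
    have ht : 0 ≤ Real.sqrt (C * ε) := Real.sqrt_nonneg _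
    obtain ⟨U, hU, hq⟩ := exists_unitary_of_transition (t := 4 * Real.sqrt (C * ε))
      (by linarith) (by linarith)
    exact ⟨U, hU, by rw [hq]; linarith, by rw [hq]; linarith⟩
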